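/- Let $n,k\ge 0$. A matching on $[m]$ may have unmatched vertices, called fixed points. A matching avoids a pattern $\tau\in S_3$ if there are no vertices $i_1<\dots<i_6$ such that $i_a$ is matched with $i_{7-\tau(a)}$ for $a=1,2,3$. Let $\mathcal M_n^k(321)$ (respectively, $\mathcal M_n^k(213)$) be the set of matchings on $[2n+k]$ with exactly $k$ fixed points such that removing the fixed points and relabelling the remaining vertices increasingly gives a $321$-avoiding (respectively, $213$-avoiding) perfect matching on $[2n]$, and such that for any vertices $x_1<\dots<x_5$ where the pairs $(x_1,x_4)$ and $(x_2,x_5)$ are matched, $x_3$ is not a fixed point (respectively, where the pairs $(x_1,x_5)$ and $(x_3,x_4)$ are matched, $x_2$ is not a fixed point). A Dyck path of semilength $N$ is a lattice path from $(0,N)$ to $(N,0)$ with east steps $(1,0)$ and south steps $(0,-1)$ that never goes below the line $x+y=N$; the height of a vertex $(x,y)$ of it is $x+y-N$. Let $\mathcal D_{n,k}^2$ be the set of pairs $(D_0,D_1)$ of Dyck paths of semilength $n+k$, both ending with $k$ south steps, such that $D_0$ never goes above $D_1$. For a matching $M$ on $[2n+k]$ with fixed points $x_1<\dots<x_k$,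 let $M^+$ be the perfect matching on $[2n+2k]$ obtained from $M$ by adding the vertices $2n+k+1,\dots,2n+2k$ and the edges $(x_i,2n+2k+1-i)$, $1\le i\le k$. Let $D_1(M)$ be the Dyck path of semilength $n+k$ whose $v$-th step is east if $v$ is the smaller element of its pair in $M^+$ (an opener), and south otherwise (a closer). Let $V_0,\dots,V_{2n+2k}$ be the vertices of $D_1(M)$ and $h_t$ the height of $V_t$. The columns of the region between the coordinate axes and $D_1(M)$, from left to right, correspond to the openers in increasing order, and its rows, from top to bottom, to the closers in increasing order; let $R(M)$ be the set of unit squares (rooks) in the column of $i$ and the row of $j$, for all pairs $(i,j)$ of $M^+$ with $i<j$. Theorem. The following two maps are bijections. 1. The map $\mathcal M_n^k(321)\to\mathcal D_{n,k}^2$, $M\mapsto(D_0,D_1(M))$, where $D_0$ is the path whose $t$-th vertex has height $2\ell_t-h_t$ for $0\le t\le 2n+2k$, with $\ell_t$ the largest size of a set of rooks of $R(M)$ inside the rectangle with opposite corners $(0,0)$ and $V_t$ whose rows increase strictly as their columns increase. 2. The map $\mathcal M_n^k(213)\to\mathcal D_{n,k}^2$, $M\mapsto(D_0,D_1(M))$,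 where $D_0$ is the border of the smallest Ferrers board (set of unit squares in the first quadrant closed under moving left and down) that contains $R(M)$. -/

import Mathlib

namespace MatchingPaths

/-- A matching, not necessarily perfect, on the linearly ordered vertex set `Fin m`, given by the
involution that sends each matched vertex to its partner and fixes each unmatched vertex. -/
@[ext] structure Matching (m : ℕ) where
  partner : Fin m → Fin m
  involutive : ∀ v, partner (partner v) = v

namespace Matching

variable {m : ℕ}

/-- The unmatched vertices, called fixed points. -/
def fixedPts (M : Matching m) : Finset (Fin m) :=
  Finset.univ.filter (fun v => M.partner v = v)

/-- The matched vertices. -/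
def matchedPts (M : Matching m) : Finset (Fin m) :=
  Finset.univ.filter (fun v => M.partner v ≠ v)

theorem mem_fixedPts (M : Matching m) (v : Fin m) :
    v ∈ M.fixedPts ↔ M.partner v = v := by
  simp [fixedPts]

theorem partner_mem_matchedPts (M : Matching m) (v : M.matchedPts) :
    M.partner v ∈ M.matchedPts := by
  obtain ⟨v, hv⟩ := v
  simp only [matchedPts, Finset.mem_filter, Finset.mem_univ, true_and] at hv ⊢
  rw [M.involutive]
  exact fun h => hv h.symm

/-- The perfect matching obtained by deleting the fixed points and relabelling the other vertices
increasingly. -/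
def removeFixed (M : Matching m) : Matching M.matchedPts.card where
  partner i := (M.matchedPts.orderIsoOfFin rfl).symm
    ⟨M.partner (M.matchedPts.orderIsoOfFin rfl i), M.partner_mem_matchedPts _⟩
  involutive i := by simp [-Finset.coe_orderIsoOfFin_apply, M.involutive]

/-- `M` avoids the pattern `τ` of length `l`: there are no vertices `i₁ < ⋯ < i₂ₗ` such that
`i_a` is matched with `i_{2l+1-τ(a)}` for all `1 ≤ a ≤ l` (indices and values of `τ` start at `0`
in the code). -/
def Avoids {l : ℕ} (M : Matching m) (τ : Equiv.Perm (Fin l)) : Prop :=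
  ¬ ∃ i : Fin (2 * l) → Fin m, StrictMono i ∧
    ∀ a : Fin l, M.partner (i (Fin.castLE (by omega) a)) =
      i (Fin.rev (Fin.castLE (by omega) (τ a)))

/-- If `x₁ < ⋯ < x_c` are the fixed points of `M`, then `M.plus` has the `c` new vertices
`m + 1, …, m + c` and the new edges `(x_i, m + c + 1 - i)` (vertices numbered from `1`). -/
def plus (M : Matching m) : Matching (m + M.fixedPts.card) where
  partner := Fin.addCases
    (fun v => if h : v ∈ M.fixedPts
      then Fin.natAdd m (Fin.rev ((M.fixedPts.orderIsoOfFin rfl).symm ⟨v, h⟩))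
      else Fin.castAdd _ (M.partner v))
    (fun j => Fin.castAdd _ (M.fixedPts.orderIsoOfFin rfl (Fin.rev j) : Fin m))
  involutive v := by
    induction v using Fin.addCases with
    | left v =>
      by_cases h : v ∈ M.fixedPts
      · simp [-Finset.coe_orderIsoOfFin_apply, h]
      · have h' : M.partner v ∉ M.fixedPts := by
          rw [mem_fixedPts] at h ⊢
          rw [M.involutive]
          exact fun e => h e.symm
        simp [h, h', M.involutive]
    | right j => simp [-Finset.coe_orderIsoOfFin_apply]

end Matching

/-! ### Lattice paths

A path is a word in the steps `U` (the east step) and `D` (the south step). -/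

/-- The (signed) distance of the `t`-th vertex of a path from the diagonal through its start. -/
def height (w : List DyckStep) (t : ℕ) : ℤ :=
  ((w.take t).count DyckStep.U : ℤ) - ((w.take t).count DyckStep.D : ℤ)

/-- The `t`-th vertex of the path `w`, when the path is drawn so that it ends on the horizontal
axis and starts on the vertical axis. -/
def vertex (w : List DyckStep) (t : ℕ) : ℕ × ℕ :=
  ((w.take t).count DyckStep.U, (w.drop t).count DyckStep.D)

/-- The unit squares in the rectangle `[0,a] × [0,b]`, where `V = (a,b)`. The square in column `x`
(from the left) and row `y` (from the bottom) is `(x, y)`; numbering starts at `0`. -/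
def rect (V : ℕ × ℕ) : Finset (ℕ × ℕ) :=
  Finset.range V.1 ×ˢ Finset.range V.2

/-- The Ferrers board whose border is the path `w`. -/
def board (w : List DyckStep) : Set (ℕ × ℕ) :=
  {s | ∃ t ≤ w.length, s ∈ rect (vertex w t)}

/-- Pairs `(D₀, D₁)` of Dyck paths of semilength `n + k`, both ending with `k` south steps, such
that `D₀` never goes above `D₁`. -/
def noncrossingPairs (n k : ℕ) : Set (DyckWord × DyckWord) :=
  {p | p.1.semilength = n + k ∧ p.2.semilength = n + k ∧
    (∀ t, height p.1.toList t ≤ height p.2.toList t) ∧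
    List.replicate k DyckStep.D <:+ p.1.toList ∧
    List.replicate k DyckStep.D <:+ p.2.toList}

/-! ### The rook placement of a perfect matching -/

section Rooks

variable {m : ℕ}

/-- The border of the shape of a perfect matching: an east step for each opener, a south step for
each closer. -/
def border (P : Matching m) : List DyckStep :=
  List.ofFn (fun v => if v < P.partner v then DyckStep.U else DyckStep.D)

/-- The rooks: one for each pair `(v, P v)` with opener `v`, in the column of `v` (columns are
numbered from left to right, so as the openers are) and the row of `P v` (rows are numbered from
bottom to top, so from the last closer to the first). -/
def rooks (P : Matching m) : Finset (ℕ × ℕ) :=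
  (Finset.univ.filter (fun v => v < P.partner v)).image (fun v =>
    ((Finset.univ.filter (fun u => u < P.partner u ∧ u < v)).card,
     (Finset.univ.filter (fun u => P.partner u < u ∧ P.partner v < u)).card))

/-- The length of the longest increasing sequence of rooks in a set of squares. -/
def longestIncreasing (R : Finset (ℕ × ℕ)) : ℕ :=
  (R.powerset.filter (fun S => ∀ p ∈ S, ∀ q ∈ S, p.1 < q.1 → p.2 < q.2)).sup Finset.card

/-- `D₁` is the border of the shape of `P`, and the `t`-th height of `D₀` is `2 ℓ_t - h_t`, where
`ℓ_t` is the length of the longest increasing sequence of rooks in the rectangle below the `t`-th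
vertex of `D₁`, and `h_t` is the height of that vertex. -/
def IsDelta321 (P : Matching m) (p : DyckWord × DyckWord) : Prop :=
  p.2.toList = border P ∧
  ∀ t ≤ m, height p.1.toList t =
    2 * (longestIncreasing (rooks P ∩ rect (vertex (border P) t)) : ℤ) - height (border P) t

/-- `D₁` is the border of the shape of `P`, and `D₀` is the border of the smallest Ferrers board
that contains all rooks of `P`. -/
def IsDelta213 (P : Matching m) (p : DyckWord × DyckWord) : Prop :=
  p.2.toList = border P ∧
  board p.1.toList = lowerClosure (rooks P : Set (ℕ × ℕ))

end Rooks

/-! ### The two classes of matchings with fixed points -/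

/-- Matchings on `2n + k` vertices with `k` fixed points whose removal leaves a `321`-avoiding
matching, such that there are no `x₁ < ⋯ < x₅` with `x₁, x₄` matched, `x₂, x₅` matched and `x₃`
fixed. -/
def matchings321 (n k : ℕ) : Set (Matching (2 * n + k)) :=
  {M | M.fixedPts.card = k ∧ M.removeFixed.Avoids (Fin.revPerm : Equiv.Perm (Fin 3)) ∧
    ∀ x₁ x₂ x₃ x₄ x₅, x₁ < x₂ → x₂ < x₃ → x₃ < x₄ → x₄ < x₅ →
      M.partner x₁ = x₄ → M.partner x₂ = x₅ → M.partner x₃ ≠ x₃}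

/-- Matchings on `2n + k` vertices with `k` fixed points whose removal leaves a `213`-avoiding
matching, such that there are no `x₁ < ⋯ < x₅` with `x₁, x₅` matched, `x₃, x₄` matched and `x₂`
fixed. -/
def matchings213 (n k : ℕ) : Set (Matching (2 * n + k)) :=
  {M | M.fixedPts.card = k ∧ M.removeFixed.Avoids (Equiv.swap 0 1 : Equiv.Perm (Fin 3)) ∧
    ∀ x₁ x₂ x₃ x₄ x₅, x₁ < x₂ → x₂ < x₃ → x₃ < x₄ → x₄ < x₅ →
      M.partner x₁ = x₅ → M.partner x₃ = x₄ → M.partner x₂ ≠ x₂}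

end MatchingPaths

/-! The added edges of `M.plus` are nested and close after everything else (in the tail), so a
forbidden fixed point of `M` is the same as an occurrence of the pattern one of whose edges ends in
the tail. Hence `M` lies in the first class iff `M.plus` has no three mutually crossing edges, and
in the second iff it has no two crossing edges over a common arc (`noTripleCrossing_plus_iff`,
`noCrossingOverArc_plus_iff`). Conversely, `exists_plus` recovers `M` from a perfect matching whose
last vertices close nested edges.

Pattern 321. Rooks below `V_t` are the edges over the gap before `t`, and increasing sequences of
rooks are nested sets of edges, so `ℓ_t` is a nesting number. Without triple crossings the `h_t`
edges over a gap split into two nested sets. This gives `ℓ ≤ h ≤ 2ℓ`, so `2ℓ - h` lies between `0`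
and `h`; it changes by `±1` at each step, and thus is the height of a path `D₀`. The inverse is an
induction that removes the edge `(p, q)` of the last opener. Let `f` be the first step from `p` on
at which `D₀` rises; then `q` is the first step after `f` at which `D₀` falls, and deleting the edge
lowers `ℓ` by one exactly on `(f, q]` (`IsEdgeSet.isPeak`). In reverse, every admissible sequence
has such a peak, and inserting its edge restores the sequence (`exists_edgeSet`). No triple crossing
arises because the other edges closing in `(p, q)` are nested precisely when their own nesting
number first falls at every closer there and then stays constant (`IsEdgeSet.nested_of_down_flat`,
`IsEdgeSet.flat_of_flat`).

Pattern 213. The rooks form a permutation matrix `R`, so their lower closure contains a staircase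
and is bordered by a Dyck path `D₀`, below `D₁`. Read on the board of `D₀`, the same rooks define a
second perfect matching, and avoidance by the first matching means that the second is noncrossing
(`noncrossing_of_noCrossingOverArc`). A noncrossing matching is determined by its openers and
closers and its rooks generate its board (`Noncrossing.board_eq`), so `D₀` determines `R`, and `R`
with `D₁` determines the matching. Existence and uniqueness of noncrossing matchings are the case `ℓ
= h` of the first part. -/

namespace MatchingPaths

/-! ### Edge sets -/

/-- `E` is a set of pairs `(opener, closer)` without a common endpoint. -/
structure IsEdgeSet (E : Finset (ℕ × ℕ)) : Prop where
  lt : ∀ e ∈ E, e.1 < e.2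
  fst_inj : ∀ e ∈ E, ∀ f ∈ E, e.1 = f.1 → e = f
  snd_inj : ∀ e ∈ E, ∀ f ∈ E, e.2 = f.2 → e = f
  fst_ne_snd : ∀ e ∈ E, ∀ f ∈ E, e.1 ≠ f.2

/-- The edges that pass over the gap before vertex `t`. -/
def live (E : Finset (ℕ × ℕ)) (t : ℕ) : Finset (ℕ × ℕ) :=
  E.filter (fun e => e.1 < t ∧ t ≤ e.2)

/-- Any two edges are nested (or disjoint, if the first one closes early). -/
def Nested (S : Finset (ℕ × ℕ)) : Prop :=
  ∀ e ∈ S, ∀ f ∈ S, e.1 < f.1 → f.2 < e.2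

/-- No three edges cross pairwise. -/
def NoTripleCrossing (E : Finset (ℕ × ℕ)) : Prop :=
  ∀ e ∈ E, ∀ f ∈ E, ∀ g ∈ E, e.1 < f.1 → f.1 < g.1 → g.1 < e.2 → e.2 < f.2 → ¬ f.2 < g.2

open scoped Classical in
/-- The largest size of a nested subset. -/
noncomputable def nestNum (S : Finset (ℕ × ℕ)) : ℕ :=
  (S.powerset.filter Nested).sup Finset.card

/-- The largest size of a nested set of edges over the gap before vertex `t`. -/
noncomputable def nest (E : Finset (ℕ × ℕ)) (t : ℕ) : ℕ := nestNum (live E t)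

theorem mem_live {E : Finset (ℕ × ℕ)} {t : ℕ} {e : ℕ × ℕ} :
    e ∈ live E t ↔ e ∈ E ∧ e.1 < t ∧ t ≤ e.2 := by
  simp [live]

theorem Nested.mono {S T : Finset (ℕ × ℕ)} (hT : Nested T) (h : S ⊆ T) : Nested S :=
  fun e he f hf => hT e (h he) f (h hf)

theorem card_le_nestNum {S T : Finset (ℕ × ℕ)} (h : T ⊆ S) (hT : Nested T) :
    T.card ≤ nestNum S := by
  classical
  exact Finset.le_sup (f := Finset.card) (by simp [h, hT])

theorem exists_nested (S : Finset (ℕ × ℕ)) :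
    ∃ T ⊆ S, Nested T ∧ T.card = nestNum S := by
  classical
  obtain ⟨T, hT, h⟩ := Finset.exists_mem_eq_sup (S.powerset.filter Nested)
    ⟨∅, by simp [Nested]⟩ Finset.card
  simp only [Finset.mem_filter, Finset.mem_powerset] at hT
  exact ⟨T, hT.1, hT.2, h.symm⟩

theorem nestNum_mono {S T : Finset (ℕ × ℕ)} (h : S ⊆ T) : nestNum S ≤ nestNum T := by
  obtain ⟨A, hA, hN, hc⟩ := exists_nested S
  exact hc ▸ card_le_nestNum (hA.trans h) hN

theorem nestNum_le_card (S : Finset (ℕ × ℕ)) : nestNum S ≤ S.card := by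
  obtain ⟨A, hA, -, hc⟩ := exists_nested S
  exact hc ▸ Finset.card_le_card hA

theorem Nested.nestNum_eq {S : Finset (ℕ × ℕ)} (h : Nested S) : nestNum S = S.card :=
  le_antisymm (nestNum_le_card S) (card_le_nestNum subset_rfl h)

theorem nested_of_nestNum_eq {S : Finset (ℕ × ℕ)} (h : nestNum S = S.card) : Nested S := by
  obtain ⟨A, hA, hN, hc⟩ := exists_nested S
  rwa [Finset.eq_of_subset_of_card_le hA (by omega)] at hN

theorem nestNum_insert_le (e : ℕ × ℕ) (S : Finset (ℕ × ℕ)) :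
    nestNum (insert e S) ≤ nestNum S + 1 := by
  obtain ⟨A, hA, hN, hc⟩ := exists_nested (insert e S)
  have h1 : (A.erase e).card ≤ nestNum S :=
    card_le_nestNum (fun x hx => by
      have := hA (Finset.mem_of_mem_erase hx)
      exact (Finset.mem_insert.1 this).resolve_left (Finset.ne_of_mem_erase hx))
      (hN.mono (Finset.erase_subset _ _))
  have := Finset.pred_card_le_card_erase (s := A) (a := e)
  omega

theorem live_succ_of_not_mem {E : Finset (ℕ × ℕ)} {t : ℕ}
    (h1 : t ∉ E.image Prod.fst) (h2 : t ∉ E.image Prod.snd) : live E (t + 1) = live E t := by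
  ext e
  simp only [mem_live]
  refine and_congr_right fun he => ?_
  have a : e.1 ≠ t := fun h => h1 (Finset.mem_image.2 ⟨e, he, h⟩)
  have b : e.2 ≠ t := fun h => h2 (Finset.mem_image.2 ⟨e, he, h⟩)
  omega

theorem IsEdgeSet.live_succ_of_fst {E : Finset (ℕ × ℕ)} (hE : IsEdgeSet E) {e : ℕ × ℕ}
    (he : e ∈ E) : live E (e.1 + 1) = insert e (live E e.1) := by
  ext f
  simp only [mem_live, Finset.mem_insert]
  have h0 := hE.lt e he
  constructor
  · rintro ⟨hf, h1, h2⟩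
    by_cases h : f.1 = e.1
    · exact Or.inl (hE.fst_inj f hf e he h)
    · exact Or.inr ⟨hf, by omega, by omega⟩
  · rintro (rfl | ⟨hf, h1, h2⟩)
    · exact ⟨he, by omega, by omega⟩
    · have := hE.fst_ne_snd e he f hf
      exact ⟨hf, by omega, by omega⟩

theorem IsEdgeSet.live_snd {E : Finset (ℕ × ℕ)} (hE : IsEdgeSet E) {e : ℕ × ℕ}
    (he : e ∈ E) : live E e.2 = insert e (live E (e.2 + 1)) := by
  ext f
  simp only [mem_live, Finset.mem_insert]
  have h0 := hE.lt e he
  constructor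
  · rintro ⟨hf, h1, h2⟩
    by_cases h : f.2 = e.2
    · exact Or.inl (hE.snd_inj f hf e he h)
    · exact Or.inr ⟨hf, by omega, by omega⟩
  · rintro (rfl | ⟨hf, h1, h2⟩)
    · exact ⟨he, by omega, by omega⟩
    · have := hE.fst_ne_snd f hf e he
      exact ⟨hf, by omega, by omega⟩

theorem nest_succ_of_not_mem {E : Finset (ℕ × ℕ)} {t : ℕ}
    (h1 : t ∉ E.image Prod.fst) (h2 : t ∉ E.image Prod.snd) : nest E (t + 1) = nest E t := by
  rw [nest, live_succ_of_not_mem h1 h2, nest]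

theorem IsEdgeSet.nest_succ_of_fst {E : Finset (ℕ × ℕ)} (hE : IsEdgeSet E) {t : ℕ}
    (h : t ∈ E.image Prod.fst) : nest E (t + 1) = nest E t ∨ nest E (t + 1) = nest E t + 1 := by
  obtain ⟨e, he, rfl⟩ := Finset.mem_image.1 h
  have h1 := nestNum_insert_le e (live E e.1)
  have h2 := nestNum_mono (Finset.subset_insert e (live E e.1))
  rw [← hE.live_succ_of_fst he] at h1 h2
  unfold nest
  omega

theorem IsEdgeSet.nest_snd {E : Finset (ℕ × ℕ)} (hE : IsEdgeSet E) {t : ℕ}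
    (h : t ∈ E.image Prod.snd) : nest E t = nest E (t + 1) ∨ nest E t = nest E (t + 1) + 1 := by
  obtain ⟨e, he, rfl⟩ := Finset.mem_image.1 h
  have h1 := nestNum_insert_le e (live E (e.2 + 1))
  have h2 := nestNum_mono (Finset.subset_insert e (live E (e.2 + 1)))
  rw [← hE.live_snd he] at h1 h2
  unfold nest
  omega

theorem nest_antitone {E : Finset (ℕ × ℕ)} {p : ℕ}
    (hp : ∀ e ∈ E, e.1 ≤ p) {s t : ℕ} (hs : p < s) (hst : s ≤ t) : nest E t ≤ nest E s := by
  refine nestNum_mono fun e he => ?_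
  rw [mem_live] at he ⊢
  have := hp e he.1
  exact ⟨he.1, by omega, by omega⟩

theorem live_zero (E : Finset (ℕ × ℕ)) : live E 0 = ∅ := by
  ext e; simp [mem_live]

theorem nestNum_empty : nestNum ∅ = 0 := by
  simpa using nestNum_le_card ∅

/-- All edges pass over one gap, so two that are not nested cross. The edges crossed by an earlier
one form a nested set, since a crossing among them would complete a triple crossing; the remaining
edges are nested by choice. -/
theorem card_le_two_mul_nestNum {S : Finset (ℕ × ℕ)} {t : ℕ}
    (hl : ∀ e ∈ S, e.1 < t ∧ t ≤ e.2)
    (h2 : ∀ e ∈ S, ∀ f ∈ S, e.2 = f.2 → e = f) (h3 : NoTripleCrossing S) :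
    S.card ≤ 2 * nestNum S := by
  classical
  have hA := card_le_nestNum (S := S)
    (T := S.filter (fun e => ∃ f ∈ S, f.1 < e.1 ∧ f.2 < e.2)) (Finset.filter_subset _ _) (by
      intro e he f hf hlt
      simp only [Finset.mem_filter] at he hf
      obtain ⟨he, g, hg, hg1, hg2⟩ := he
      by_contra hc
      have hne : e.2 ≠ f.2 := fun h => by rw [h2 e he f hf.1 h] at hlt; omega
      have := hl f hf.1
      have := hl g hg
      exact h3 g hg e he f hf.1 hg1 hlt (by omega) hg2 (by omega))
  have hB := card_le_nestNum (S := S)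
    (T := S.filter (fun e => ¬ ∃ f ∈ S, f.1 < e.1 ∧ f.2 < e.2)) (Finset.filter_subset _ _) (by
      intro e he f hf hlt
      simp only [Finset.mem_filter, not_exists, not_and] at he hf
      have hne : e.2 ≠ f.2 := fun h => by rw [h2 e he.1 f hf.1 h] at hlt; omega
      have := hf.2 e he.1 hlt
      omega)
  have := Finset.card_filter_add_card_filter_not (s := S)
    (fun e => ∃ f ∈ S, f.1 < e.1 ∧ f.2 < e.2)
  omega

theorem NoTripleCrossing.mono {E F : Finset (ℕ × ℕ)} (hF : NoTripleCrossing F) (h : E ⊆ F) :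
    NoTripleCrossing E :=
  fun e he f hf g hg => hF e (h he) f (h hf) g (h hg)

theorem IsEdgeSet.mono {E F : Finset (ℕ × ℕ)} (hF : IsEdgeSet F) (h : E ⊆ F) : IsEdgeSet E where
  lt e he := hF.lt e (h he)
  fst_inj e he f hf := hF.fst_inj e (h he) f (h hf)
  snd_inj e he f hf := hF.snd_inj e (h he) f (h hf)
  fst_ne_snd e he f hf := hF.fst_ne_snd e (h he) f (h hf)

/-- The number of elements of `S` below `t`. -/
def countBelow (S : Finset ℕ) (t : ℕ) : ℕ := (S.filter (· < t)).card

theorem countBelow_zero (S : Finset ℕ) : countBelow S 0 = 0 := by simp [countBelow]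

theorem countBelow_succ (S : Finset ℕ) (t : ℕ) :
    countBelow S (t + 1) = countBelow S t + if t ∈ S then 1 else 0 := by
  unfold countBelow
  split_ifs with h
  · rw [← Finset.card_insert_of_notMem (a := t) (by simp)]
    congr 1
    ext x
    simp only [Finset.mem_filter, Finset.mem_insert]
    constructor
    · rintro ⟨h1, h2⟩
      by_cases hx : x = t
      · exact Or.inl hx
      · exact Or.inr ⟨h1, by omega⟩
    · rintro (rfl | ⟨h1, h2⟩)
      · exact ⟨h, by omega⟩
      · exact ⟨h1, by omega⟩
  · rw [add_zero]
    congr 1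
    ext x
    simp only [Finset.mem_filter]
    refine and_congr_right fun hx => ?_
    have : x ≠ t := fun e => h (e ▸ hx)
    omega

theorem countBelow_eq_card {S : Finset ℕ} {t : ℕ} (h : ∀ x ∈ S, x < t) :
    countBelow S t = S.card := by
  rw [countBelow, Finset.filter_true_of_mem h]

theorem countBelow_erase {S : Finset ℕ} {p : ℕ} (hp : p ∈ S) (t : ℕ) :
    countBelow S t = countBelow (S.erase p) t + if p < t then 1 else 0 := by
  unfold countBelow
  rw [Finset.filter_erase]
  split_ifs with h
  · rw [Finset.card_erase_add_one (by simp [hp, h])]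
  · rw [Finset.erase_eq_of_notMem (by simp [h]), add_zero]

theorem countBelow_mono (S : Finset ℕ) {s t : ℕ} (h : s ≤ t) : countBelow S s ≤ countBelow S t :=
  Finset.card_le_card (fun x hx => by simp only [Finset.mem_filter] at hx ⊢; exact ⟨hx.1, by omega⟩)

/-- An edge opened before `t` is either closed before `t` or live. This makes the height of `D₁` the
number of live edges, in additive form to avoid truncated subtraction. -/
theorem IsEdgeSet.card_live {E : Finset (ℕ × ℕ)} (hE : IsEdgeSet E) (t : ℕ) :
    countBelow (E.image Prod.fst) t = (live E t).card + countBelow (E.image Prod.snd) t := by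
  have h1 : countBelow (E.image Prod.fst) t = (E.filter (fun e => e.1 < t)).card := by
    rw [countBelow, Finset.filter_image, Finset.card_image_of_injOn]
    intro e he f hf h
    simp only [Finset.coe_filter, Set.mem_ofPred_eq] at he hf
    exact hE.fst_inj e he.1 f hf.1 h
  have h2 : countBelow (E.image Prod.snd) t = (E.filter (fun e => e.2 < t)).card := by
    rw [countBelow, Finset.filter_image, Finset.card_image_of_injOn]
    intro e he f hf h
    simp only [Finset.coe_filter, Set.mem_ofPred_eq] at he hf
    exact hE.snd_inj e he.1 f hf.1 h
  rw [h1, h2, ← Finset.card_filter_add_card_filter_not (s := E.filter (fun e => e.1 < t))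
    (fun e => t ≤ e.2), Finset.filter_filter, Finset.filter_filter, live]
  congr 2
  ext e
  simp only [Finset.mem_filter]
  refine and_congr_right fun he => ?_
  have := hE.lt e he
  omega

/-- `ℓ` can be the sequence of nesting numbers of a matching with openers `O` and closers `C`
without triple crossings. -/
structure IsProfile (O C : Finset ℕ) (ℓ : ℕ → ℕ) : Prop where
  disj : ∀ t ∈ O, t ∉ C
  card_eq : O.card = C.card
  zero : ℓ 0 = 0
  opener : ∀ t ∈ O, ℓ (t + 1) = ℓ t ∨ ℓ (t + 1) = ℓ t + 1
  closer : ∀ t ∈ C, ℓ t = ℓ (t + 1) ∨ ℓ t = ℓ (t + 1) + 1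
  other : ∀ t, t ∉ O → t ∉ C → ℓ (t + 1) = ℓ t
  -- With `h` the height of `D₁`, the two bounds say `ℓ ≤ h ≤ 2ℓ`, that is, `0 ≤ 2ℓ - h ≤ h`.
  le_height : ∀ t, ℓ t + countBelow C t ≤ countBelow O t
  height_le : ∀ t, countBelow O t ≤ 2 * ℓ t + countBelow C t

theorem IsEdgeSet.isProfile {E : Finset (ℕ × ℕ)} (hE : IsEdgeSet E) (h3 : NoTripleCrossing E) :
    IsProfile (E.image Prod.fst) (E.image Prod.snd) (nest E) where
  disj t h1 h2 := by
    obtain ⟨e, he, rfl⟩ := Finset.mem_image.1 h1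
    obtain ⟨f, hf, h⟩ := Finset.mem_image.1 h2
    exact hE.fst_ne_snd e he f hf h.symm
  card_eq := by
    rw [Finset.card_image_of_injOn fun e he f hf h => hE.fst_inj e he f hf h,
      Finset.card_image_of_injOn fun e he f hf h => hE.snd_inj e he f hf h]
  zero := by rw [nest, live_zero, nestNum_empty]
  opener _ h := hE.nest_succ_of_fst h
  closer _ h := hE.nest_snd h
  other _ h1 h2 := nest_succ_of_not_mem h1 h2
  le_height t := by
    have := nestNum_le_card (live E t)
    rw [hE.card_live t, nest]
    omega
  height_le t := by
    have := card_le_two_mul_nestNum (S := live E t) (t := t) (fun e he => (mem_live.1 he).2)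
      (fun e he f hf => hE.snd_inj e (mem_live.1 he).1 f (mem_live.1 hf).1)
      (h3.mono (Finset.filter_subset _ _))
    rw [hE.card_live t, nest]
    omega

/-! ### The last edge of a profile -/

/-- The opener `p` starts, and the closer `q` ends, a peak of `2 ℓ_t - h_t` (`p ≤ f < q`, the
sequence goes up at `f`, stays flat in between and goes down at `q`). -/
structure IsPeak (C : Finset ℕ) (ℓ : ℕ → ℕ) (p f q : ℕ) : Prop where
  p_le : p ≤ f
  f_lt : f < q
  q_mem : q ∈ C
  -- At an opener `2ℓ - h` rises iff `ℓ` does; at a closer it rises iff `ℓ` stays constant. So `f`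
  -- is the first rise from `p` on: either `p` itself, or a closer at which `ℓ` stays constant.
  start_eq : f = p → ℓ (p + 1) = ℓ p + 1
  start_ne : f ≠ p → ℓ (p + 1) = ℓ p ∧ f ∈ C ∧ ℓ (f + 1) = ℓ f
  down : ∀ c ∈ C, p < c → c < f → ℓ c = ℓ (c + 1) + 1
  flat : ∀ t, f < t → t ≤ q → ℓ t = ℓ (f + 1)
  last : ℓ q = ℓ (q + 1) + 1

/-- From `p` on, `f` is the first rise of `2ℓ - h` and `q` is the first fall after `f`. -/
theorem IsPeak.unique {C : Finset ℕ} {ℓ : ℕ → ℕ} {p f q f' q' : ℕ} (h : IsPeak C ℓ p f q)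
    (h' : IsPeak C ℓ p f' q') : f = f' ∧ q = q' := by
  have key : ∀ {f q f' q'}, IsPeak C ℓ p f q → IsPeak C ℓ p f' q' → ¬ f < f' := by
    intro f q f' q' h h' hlt
    have h1 := h'.start_ne (by have := h.p_le; omega)
    by_cases hf : f = p
    · have := h.start_eq hf
      omega
    · have h2 := h.start_ne hf
      have := h'.down f h2.2.1 (by have := h.p_le; omega) hlt
      omega
  have hff : f = f' := le_antisymm (not_lt.1 (key h' h)) (not_lt.1 (key h h'))
  subst hff
  have key2 : ∀ {q q'}, IsPeak C ℓ p f q → IsPeak C ℓ p f q' → ¬ q < q' := by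
    intro q q' h h' hlt
    have h1 := h'.flat (q + 1) (by have := h.f_lt; omega) (by omega)
    have h2 := h'.flat q h.f_lt (by omega)
    have := h.last
    omega
  exact ⟨rfl, le_antisymm (not_lt.1 (key2 h' h)) (not_lt.1 (key2 h h'))⟩

/-- The sequence `ℓ`, lowered by one on the interval `(f, q]`. -/
def lowered (ℓ : ℕ → ℕ) (f q t : ℕ) : ℕ := if f < t ∧ t ≤ q then ℓ t - 1 else ℓ t

section

variable {O C : Finset ℕ} {ℓ : ℕ → ℕ} {p : ℕ}

theorem IsProfile.eq_zero (h : IsProfile O C ℓ) :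
    ∃ T, ∀ t, T ≤ t → ℓ t = 0 ∧ countBelow C t = C.card ∧ countBelow O t = C.card := by
  refine ⟨(O ∪ C).sup id + 1, fun t ht => ?_⟩
  have hb : ∀ x ∈ O ∪ C, x < t := fun x hx => by
    have := Finset.le_sup (f := id) hx
    simp only [id] at this
    omega
  have h1 := countBelow_eq_card (S := O) (t := t) fun x hx => hb x (Finset.mem_union_left _ hx)
  have h2 := countBelow_eq_card (S := C) (t := t) fun x hx => hb x (Finset.mem_union_right _ hx)
  have := h.le_height t
  have := h.card_eq
  omega

theorem IsProfile.succ_le (h : IsProfile O C ℓ) (hp : ∀ x ∈ O, x ≤ p) {t : ℕ} (ht : p < t) :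
    ℓ (t + 1) ≤ ℓ t := by
  have hO : t ∉ O := fun hO => by have := hp t hO; omega
  by_cases hC : t ∈ C
  · have := h.closer t hC
    omega
  · exact (h.other t hO hC).le

theorem IsProfile.antitone (h : IsProfile O C ℓ) (hp : ∀ x ∈ O, x ≤ p) {s t : ℕ} (hs : p < s)
    (hst : s ≤ t) : ℓ t ≤ ℓ s := by
  induction t, hst using Nat.le_induction with
  | base => rfl
  | succ t ht ih => exact (h.succ_le hp (by omega)).trans ih

theorem IsProfile.countBelow_opener (hp : ∀ x ∈ O, x ≤ p) {t : ℕ} (ht : p < t) :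
    countBelow O t = O.card :=
  countBelow_eq_card fun x hx => by have := hp x hx; omega

/-- While every closer is a down step, the defect `h - ℓ` stays constant. -/
theorem IsProfile.add_countBelow_eq (h : IsProfile O C ℓ) (hp : ∀ x ∈ O, x ≤ p) {s t : ℕ}
    (hs : p < s) (hst : s ≤ t) (hd : ∀ c ∈ C, s ≤ c → c < t → ℓ c = ℓ (c + 1) + 1) :
    ℓ t + countBelow C t = ℓ s + countBelow C s := by
  induction t, hst using Nat.le_induction with
  | base => rfl
  | succ t ht ih =>
    have ih := ih fun c hc h1 h2 => hd c hc h1 (by omega)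
    have hO : t ∉ O := fun hO => by have := hp t hO; omega
    rw [countBelow_succ]
    split_ifs with hC
    · have := hd t hC ht (by omega)
      omega
    · rw [h.other t hO hC]
      omega

/-- Past the last opener `ℓ` decreases weakly to zero, so it must leave the positive value `ℓ (f +
1)`; `q` is the closer at which it does. -/
theorem IsProfile.exists_last (h : IsProfile O C ℓ) (hp : ∀ x ∈ O, x ≤ p) {f : ℕ} (hf : p ≤ f)
    (hpos : 0 < ℓ (f + 1)) : ∃ q, f < q ∧ q ∈ C ∧ (∀ t, f < t → t ≤ q → ℓ t = ℓ (f + 1)) ∧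
      ℓ q = ℓ (q + 1) + 1 := by
  classical
  obtain ⟨T, hT⟩ := h.eq_zero
  have hex : ∃ q, f < q ∧ ℓ (q + 1) < ℓ (f + 1) := by
    refine ⟨max T (f + 1), by omega, ?_⟩
    rw [(hT _ (by omega)).1]
    exact hpos
  obtain ⟨h1, h2⟩ := Nat.find_spec hex
  have hmin := fun t (ht : t < Nat.find hex) => Nat.find_min hex ht
  set q := Nat.find hex
  have hflat : ∀ t, f < t → t ≤ q → ℓ t = ℓ (f + 1) := by
    intro t h3 h4
    obtain ⟨t, rfl⟩ : ∃ s, t = s + 1 := ⟨t - 1, by omega⟩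
    refine le_antisymm (h.antitone hp (by omega) (by omega)) ?_
    by_cases hft : f < t
    · have := hmin t (by omega)
      omega
    · rw [show t = f by omega]
  have h5 := hflat q h1 le_rfl
  have hO : q ∉ O := fun hO => by have := hp q hO; omega
  have hC : q ∈ C := by
    by_contra hC
    have := h.other q hO hC
    omega
  refine ⟨q, h1, hC, hflat, ?_⟩
  have := h.closer q hC
  omega

theorem IsProfile.exists_peak (h : IsProfile O C ℓ) (hpO : p ∈ O) (hp : ∀ x ∈ O, x ≤ p) :
    ∃ f q, IsPeak C ℓ p f q := by
  classical
  rcases h.opener p hpO with h0 | h0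
  -- If every closer after `p` were a down step, the defect `h - ℓ` would be constant from `p + 1`
  -- on. It vanishes at the end, but is at least one at `p + 1`, because `h` rises at the opener `p`
  -- and `ℓ` does not.
  · have hex : ∃ f, p < f ∧ f ∈ C ∧ ℓ (f + 1) = ℓ f := by
      by_contra hno
      push Not at hno
      obtain ⟨T, hT⟩ := h.eq_zero
      have h1 := h.add_countBelow_eq hp (s := p + 1) (t := max T (p + 1)) (by omega) (by omega)
        fun c hc h1 _ => by
          have := hno c (by omega) hc
          have := h.closer c hc
          omega
      obtain ⟨h2, h3, -⟩ := hT (max T (p + 1)) (by omega)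
      have h4 := h.le_height p
      have h5 := countBelow_succ C p
      have h6 := countBelow_succ O p
      have h7 := IsProfile.countBelow_opener hp (t := p + 1) (by omega)
      have := h.card_eq
      rw [if_neg (h.disj p hpO)] at h5
      rw [if_pos hpO] at h6
      omega
    obtain ⟨h1, h2, h3⟩ := Nat.find_spec hex
    have hmin := fun t (ht : t < Nat.find hex) => Nat.find_min hex ht
    set f := Nat.find hex
    -- Positivity of `ℓ (f + 1)`: by `ℓ ≤ h` after the closer `f`, `ℓ + 1 ≤ h` before it, and `h ≤
    -- 2ℓ` there.
    have h4 := h.height_le f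
    have h5 := h.le_height (f + 1)
    have h6 := countBelow_succ C f
    have h7 := IsProfile.countBelow_opener hp (t := f) (by omega)
    have h8 := IsProfile.countBelow_opener hp (t := f + 1) (by omega)
    rw [if_pos h2] at h6
    obtain ⟨q, hq1, hq2, hq3, hq4⟩ := h.exists_last hp (f := f) (by omega) (by omega)
    refine ⟨f, q, by omega, hq1, hq2, fun _ => by omega, fun _ => ⟨h0, h2, h3⟩, ?_, hq3, hq4⟩
    intro c hc hpc hcf
    have := hmin c hcf
    have := h.closer c hc
    have : ℓ (c + 1) ≠ ℓ c := fun e => by tauto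
    omega
  · obtain ⟨q, hq1, hq2, hq3, hq4⟩ := h.exists_last hp (f := p) le_rfl (by omega)
    exact ⟨p, q, le_rfl, hq1, hq2, fun _ => h0, fun h => absurd rfl h,
      fun c _ _ _ => by omega, hq3, hq4⟩

/-- Erasing `p` and `q` lowers `h` by one on `(p, q]`, while `ℓ` drops only on `(f, q]`. On `(p, f]`
the bound `ℓ ≤ h` survives because the defect `h - ℓ` keeps the value from `p + 1`, which is
positive. On `(f, q]` the bound `h ≤ 2ℓ` survives because `2ℓ - h` has just risen at `f` and does
not fall before `q`. -/
theorem IsProfile.lowered (h : IsProfile O C ℓ) (hpO : p ∈ O) (hp : ∀ x ∈ O, x ≤ p) {f q : ℕ}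
    (hk : IsPeak C ℓ p f q) : IsProfile (O.erase p) (C.erase q) (lowered ℓ f q) := by
  obtain ⟨k1, k2, k3, k4, k5, k6, k7, k8⟩ := hk
  have hpos : ∀ t, f < t → t ≤ q → 0 < ℓ t := fun t h1 h2 => by
    rw [k7 t h1 h2, ← k7 q k2 le_rfl]
    omega
  have hpC := h.disj p hpO
  refine ⟨?_, ?_, ?_, ?_, ?_, ?_, ?_, ?_⟩
  · intro t h1 h2
    exact h.disj t (Finset.mem_of_mem_erase h1) (Finset.mem_of_mem_erase h2)
  · rw [Finset.card_erase_of_mem hpO, Finset.card_erase_of_mem k3, h.card_eq]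
  · simp [MatchingPaths.lowered, h.zero]
  · intro t ht
    obtain ⟨h1, h2⟩ := Finset.mem_erase.1 ht
    have h3 := hp t h2
    have := h.opener t h2
    unfold MatchingPaths.lowered
    rw [if_neg (by omega), if_neg (by omega)]
    exact this
  · intro t ht
    obtain ⟨h1, h2⟩ := Finset.mem_erase.1 ht
    have h3 : t ≠ p := fun e => hpC (e ▸ h2)
    have h4 := h.closer t h2
    have h5 := hpos (t + 1)
    have h6 := hpos t
    unfold MatchingPaths.lowered
    by_cases hft : t = f
    · subst hft
      have := k5 h3
      split_ifs <;> omega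
    · split_ifs <;> omega
  · intro t h1 h2
    have h3 : t ∈ O → t = p := fun h => by
      by_contra hne; exact h1 (Finset.mem_erase.2 ⟨hne, h⟩)
    have h4 : t ∈ C → t = q := fun h => by
      by_contra hne; exact h2 (Finset.mem_erase.2 ⟨hne, h⟩)
    have h5 := hpos (t + 1)
    have h6 := hpos t
    unfold MatchingPaths.lowered
    by_cases hO : t ∈ O
    · obtain rfl := h3 hO
      by_cases hf : f = t
      · have := k4 hf
        split_ifs <;> omega
      · have := k5 hf
        split_ifs <;> omega
    · by_cases hC : t ∈ C
      · obtain rfl := h4 hC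
        split_ifs <;> omega
      · have := h.other t hO hC
        have : t ≠ f := fun e => by
          by_cases hf : f = p
          · exact hO (by rw [e, hf]; exact hpO)
          · exact hC (e ▸ (k5 hf).2.1)
        have : t ≠ q := fun e => hC (e ▸ k3)
        split_ifs <;> omega
  · intro t
    have h1 := countBelow_erase hpO t
    have h2 := countBelow_erase k3 t
    have h3 := h.le_height t
    have h4 := hpos t
    unfold MatchingPaths.lowered
    by_cases ht : p < t ∧ t ≤ f
    · have h5 := k5 (by omega)
      have h6 := h.add_countBelow_eq hp (s := p + 1) (t := t) (by omega) (by omega)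
        fun c hc a b => k6 c hc (by omega) (by omega)
      have h7 := h.le_height p
      have h8 := countBelow_succ C p
      have h9 := countBelow_succ O p
      have h10 := IsProfile.countBelow_opener hp (t := p + 1) (by omega)
      have h11 := IsProfile.countBelow_opener hp (t := t) (by omega)
      rw [if_neg hpC] at h8
      rw [if_pos hpO] at h9
      rw [if_pos (by omega)] at h1
      rw [if_neg (by omega)] at h2
      rw [if_neg (by omega)]
      omega
    · split_ifs at * <;> omega
  · intro t
    have h1 := countBelow_erase hpO t
    have h2 := countBelow_erase k3 t
    have h3 := h.height_le t
    unfold MatchingPaths.lowered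
    by_cases ht : f < t ∧ t ≤ q
    · have h4 := k7 t ht.1 ht.2
      have h5 := countBelow_mono C (s := f + 1) (t := t) (by omega)
      have h6 : countBelow O (f + 1) + 1 ≤ 2 * ℓ (f + 1) + countBelow C (f + 1) := by
        have h7 := h.height_le f
        have h8 := countBelow_succ C f
        have h9 := countBelow_succ O f
        by_cases hf : f = p
        · subst hf
          have := k4 rfl
          rw [if_neg hpC] at h8
          rw [if_pos hpO] at h9
          omega
        · have := k5 hf
          have hO : f ∉ O := fun hO => by have := hp f hO; omega
          rw [if_pos this.2.1] at h8
          rw [if_neg hO] at h9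
          omega
      have h10 := IsProfile.countBelow_opener hp (t := f + 1) (by omega)
      have h11 := IsProfile.countBelow_opener hp (t := t) (by omega)
      rw [if_pos (by omega)] at h1
      rw [if_neg (by omega)] at h2
      rw [if_pos ht]
      omega
    · split_ifs at * <;> omega

end

/-! ### Inserting the last edge -/

section

variable {E : Finset (ℕ × ℕ)} {p q : ℕ}

theorem IsEdgeSet.insert_edge (hE : IsEdgeSet E) (hpq : p < q) (h1 : ∀ e ∈ E, e.1 ≠ p ∧ e.1 ≠ q)
    (h2 : ∀ e ∈ E, e.2 ≠ p ∧ e.2 ≠ q) : IsEdgeSet (insert (p, q) E) where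
  lt e he := by
    rcases Finset.mem_insert.1 he with rfl | he
    exacts [hpq, hE.lt e he]
  fst_inj e he f hf h := by
    rcases Finset.mem_insert.1 he with rfl | he <;> rcases Finset.mem_insert.1 hf with rfl | hf
    exacts [rfl, absurd h.symm (h1 f hf).1, absurd h (h1 e he).1, hE.fst_inj e he f hf h]
  snd_inj e he f hf h := by
    rcases Finset.mem_insert.1 he with rfl | he <;> rcases Finset.mem_insert.1 hf with rfl | hf
    exacts [rfl, absurd h.symm (h2 f hf).2, absurd h (h2 e he).2, hE.snd_inj e he f hf h]
  fst_ne_snd e he f hf h := by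
    rcases Finset.mem_insert.1 he with rfl | he <;> rcases Finset.mem_insert.1 hf with rfl | hf
    exacts [hpq.ne h, (h2 f hf).1 h.symm, (h1 e he).2 h, hE.fst_ne_snd e he f hf h]

/-- Since `p` is the last opener, `(p, q)` is the innermost edge of any nested set over a gap that
contains it. The other members then close after `q` and form a nested set over the gap before `q +
1`. -/
theorem nest_insert (hp : ∀ e ∈ E, e.1 < p) (t : ℕ) :
    nest (insert (p, q) E) t =
      if p < t ∧ t ≤ q then max (nest E t) (nest E (q + 1) + 1) else nest E t := by
  split_ifs with ht
  · apply le_antisymm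
    · obtain ⟨S, hS, hN, hc⟩ := exists_nested (live (insert (p, q) E) t)
      rw [nest, ← hc]
      by_cases hm : (p, q) ∈ S
      · refine le_max_of_le_right ?_
        have h1 : (S.erase (p, q)).card ≤ nest E (q + 1) := by
          refine card_le_nestNum (fun e he => ?_) (hN.mono (Finset.erase_subset _ _))
          obtain ⟨h1, h2⟩ := Finset.mem_erase.1 he
          obtain ⟨h3, h4, h5⟩ := mem_live.1 (hS h2)
          have h3 := (Finset.mem_insert.1 h3).resolve_left h1
          have h6 := hp e h3
          have := hN e h2 (p, q) hm h6
          exact mem_live.2 ⟨h3, by omega, by simpa using this⟩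
        have := Finset.card_erase_add_one hm
        omega
      · refine le_max_of_le_left (card_le_nestNum (fun e he => ?_) hN)
        obtain ⟨h3, h4, h5⟩ := mem_live.1 (hS he)
        exact mem_live.2 ⟨(Finset.mem_insert.1 h3).resolve_left (fun h => hm (h ▸ he)), h4, h5⟩
    · refine max_le ?_ ?_
      · exact nestNum_mono (Finset.filter_subset_filter _ (Finset.subset_insert _ _))
      · obtain ⟨S, hS, hN, hc⟩ := exists_nested (live E (q + 1))
        rw [nest, ← hc]
        have hm : (p, q) ∉ S := fun h => by have := mem_live.1 (hS h); simp at this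
        rw [← Finset.card_insert_of_notMem hm]
        refine card_le_nestNum (fun e he => ?_) fun e he f hf hef => ?_
        · rcases Finset.mem_insert.1 he with rfl | he
          · exact mem_live.2 ⟨Finset.mem_insert_self _ _, ht.1, ht.2⟩
          · obtain ⟨h3, h4, h5⟩ := mem_live.1 (hS he)
            have := hp e h3
            exact mem_live.2 ⟨Finset.mem_insert_of_mem h3, by omega, by omega⟩
        · rcases Finset.mem_insert.1 he with rfl | he <;>
            rcases Finset.mem_insert.1 hf with rfl | hf
          · exact absurd hef (lt_irrefl _)
          · have := hp f (mem_live.1 (hS hf)).1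
            simp only at hef
            omega
          · have := (mem_live.1 (hS he)).2.2
            simp only
            omega
          · exact hN e he f hf hef
  · rw [nest, nest]
    congr 1
    ext e
    simp only [mem_live, Finset.mem_insert]
    constructor
    · rintro ⟨rfl | h1, h2⟩
      exacts [absurd h2 ht, ⟨h1, h2⟩]
    · rintro ⟨h1, h2⟩
      exact ⟨Or.inr h1, h2⟩

/-- If every closer in `[a, a + d)` is a down step, then every largest nested set over the gap
before `a` contains all edges that close there. -/
theorem IsEdgeSet.mem_of_down (hE : IsEdgeSet E) : ∀ (d a : ℕ), (∀ e ∈ E, e.1 < a) →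
    (∀ e ∈ E, a ≤ e.2 → e.2 < a + d → nest E e.2 = nest E (e.2 + 1) + 1) →
    ∀ S ⊆ live E a, Nested S → S.card = nest E a →
    ∀ e ∈ E, a ≤ e.2 → e.2 < a + d → e ∈ S := by
  intro d
  induction d with
  | zero => intros; omega
  | succ d ih =>
    intro a ha hd S hS hN hc e he h1 h2
    by_cases hC : a ∈ E.image Prod.snd
    · obtain ⟨g, hg, rfl⟩ := Finset.mem_image.1 hC
      have hl := hE.live_snd hg
      have hdg := hd g hg le_rfl (by omega)
      -- A set that omits `g` fits over the next gap, where the nesting number is smaller by one.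
      have hgS : g ∈ S := by
        by_contra hgS
        have : S.card ≤ nest E (g.2 + 1) := card_le_nestNum (fun x hx => by
          have := hS hx
          rw [hl] at this
          exact (Finset.mem_insert.1 this).resolve_left fun h => hgS (h ▸ hx)) hN
        omega
      by_cases heg : e = g
      · exact heg ▸ hgS
      have hne : e.2 ≠ g.2 := fun h => heg (hE.snd_inj e he g hg h)
      refine Finset.mem_of_mem_erase (ih (g.2 + 1) (fun x hx => (ha x hx).trans (by omega))
        (fun x hx h3 h4 => hd x hx (by omega) (by omega)) (S.erase g) ?_
        (hN.mono (Finset.erase_subset _ _)) ?_ e he (by omega) (by omega))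
      · intro x hx
        obtain ⟨h3, h4⟩ := Finset.mem_erase.1 hx
        have := hS h4
        rw [hl] at this
        exact (Finset.mem_insert.1 this).resolve_left h3
      · have := Finset.card_erase_add_one hgS
        omega
    · have hO : a ∉ E.image Prod.fst := fun h => by
        obtain ⟨g, hg, h⟩ := Finset.mem_image.1 h
        exact (ha g hg).ne h
      have hl := live_succ_of_not_mem hO hC
      have hne : e.2 ≠ a := fun h => hC (Finset.mem_image.2 ⟨e, he, h⟩)
      refine ih (a + 1) (fun x hx => (ha x hx).trans (by omega))
        (fun x hx h3 h4 => hd x hx (by omega) (by omega)) S (hl ▸ hS) hN ?_ e he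
        (by omega) (by omega)
      rw [hc, nest, nest, hl]

/-- If the closers in `(p, q)` are first down steps and then flat steps, then the edges closing
there do not cross. -/
theorem IsEdgeSet.nested_of_down_flat (hE : IsEdgeSet E) (h3 : NoTripleCrossing E)
    (hp : ∀ e ∈ E, e.1 < p)
    (hdf : ∀ e ∈ E, ∀ f ∈ E, p < e.2 → e.2 < f.2 → f.2 < q →
      nest E f.2 = nest E (f.2 + 1) + 1 → nest E e.2 = nest E (e.2 + 1) + 1)
    {e f : ℕ × ℕ} (he : e ∈ E) (hf : f ∈ E) (hpe : p < e.2) (hef : e.2 < f.2) (hfq : f.2 < q) :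
    f.1 < e.1 := by
  by_contra hc
  have hlt : e.1 < f.1 := by
    have : e.1 ≠ f.1 := fun h => by rw [hE.fst_inj e he f hf h] at hef; omega
    omega
  -- If `f` closes at a down step, so do all edges that close from `e.2` to `f.2`; a largest nested
  -- set over the gap before `e.2` then contains both `e` and `f`.
  by_cases hd : nest E f.2 = nest E (f.2 + 1) + 1
  · obtain ⟨S, hS, hN, hcard⟩ := exists_nested (live E e.2)
    have key := hE.mem_of_down (f.2 + 1 - e.2) e.2 (fun x hx => (hp x hx).trans hpe)
      (fun x hx h1 h2 => by
        by_cases hx2 : x.2 = f.2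
        · rw [hx2, hd]
        · exact hdf x hx f hf (by omega) (by omega) hfq hd) S hS hN hcard
    have := hN e (key e he le_rfl (by omega)) f (key f hf (by omega) (by omega)) hlt
    omega
  · have hd' : nest E f.2 = nest E (f.2 + 1) :=
      (hE.nest_snd (Finset.mem_image_of_mem _ hf)).resolve_right hd
    -- At a flat closer, `f` cannot extend a largest nested set over the next gap. The obstruction
    -- is a member that opens and closes after `f`, and it completes a triple crossing with `e` and
    -- `f`.
    obtain ⟨S, hS, hN, hcard⟩ := exists_nested (live E (f.2 + 1))
    have hfS : f ∉ S := fun h => by have := mem_live.1 (hS h); omega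
    have : (insert f S).card ≤ nest E f.2 := by
      rw [nest, hE.live_snd hf]
      refine card_le_nestNum (Finset.insert_subset_insert _ hS) fun x hx y hy hxy => ?_
      rcases Finset.mem_insert.1 hx with rfl | hx' <;> rcases Finset.mem_insert.1 hy with rfl | hy
      · omega
      · obtain ⟨h4, h5, h6⟩ := mem_live.1 (hS hy)
        have := hp y h4
        exact absurd (show x.2 < y.2 by omega) (h3 e he x hf y h4 hlt hxy (by omega) hef)
      · have := mem_live.1 (hS hx')
        omega
      · exact hN x hx' y hy hxy
    rw [Finset.card_insert_of_notMem hfS, hcard] at this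
    unfold nest at *
    omega

/-- If the edges that close in `(p, q)` do not cross, then the closers there are first down steps
and then flat steps. -/
theorem IsEdgeSet.flat_of_flat (hE : IsEdgeSet E) (hp : ∀ e ∈ E, e.1 < p)
    (hn : ∀ e ∈ E, ∀ f ∈ E, p < e.2 → e.2 < f.2 → f.2 < q → f.1 < e.1)
    {e : ℕ × ℕ} (he : e ∈ E) (hpe : p < e.2) (hfl : nest E e.2 = nest E (e.2 + 1)) :
    ∀ t, e.2 ≤ t → t < q → nest E t = nest E (t + 1) := by
  intro t
  induction t using Nat.strong_induction_on with
  | _ t ih =>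
    intro h1 h2
    have hconst : ∀ s, e.2 ≤ s → s ≤ t → nest E s = nest E e.2 := by
      intro s hs
      induction s, hs using Nat.le_induction with
      | base => intro; rfl
      | succ s hs ih2 =>
        intro h
        rw [← ih s (by omega) hs (by omega), ih2 (by omega)]
    by_cases hte : t = e.2
    · rw [hte, hfl]
    have hO : t ∉ E.image Prod.fst := fun h => by
      obtain ⟨g, hg, h⟩ := Finset.mem_image.1 h
      have := hp g hg
      omega
    by_cases hC : t ∈ E.image Prod.snd
    -- Suppose `f` closes at the first down step after the flat one. A largest nested set there
    -- contains `f`, and its other members open before `f`, while `e` opens after `f`. Hence `e`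
    -- extends it to a larger nested set over the gap before `e.2`, although the nesting number has
    -- not changed since then.
    · refine (hE.nest_snd hC).resolve_right fun hd => ?_
      obtain ⟨f, hf, rfl⟩ := Finset.mem_image.1 hC
      obtain ⟨S, hS, hN, hcard⟩ := exists_nested (live E f.2)
      have hfS := hE.mem_of_down 1 f.2 (fun x hx => (hp x hx).trans (by omega))
        (fun x hx h3 h4 => by rw [show x.2 = f.2 by omega, hd]) S hS hN hcard f hf le_rfl
        (by omega)
      have hfe := hn e he f hf hpe (by omega) h2
      have heS : e ∉ S := fun h => by have := mem_live.1 (hS h); omega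
      have hin : ∀ x ∈ S, x.1 < e.1 := fun x hx => by
        by_contra hc
        have := hN f hfS x hx (by omega)
        have := mem_live.1 (hS hx)
        omega
      have : (insert e S).card ≤ nest E e.2 := by
        refine card_le_nestNum (fun x hx => ?_) fun x hx y hy hxy => ?_
        · rcases Finset.mem_insert.1 hx with rfl | hx
          · exact mem_live.2 ⟨he, hE.lt x he, le_rfl⟩
          · obtain ⟨h4, h5, h6⟩ := mem_live.1 (hS hx)
            have := hp x h4
            exact mem_live.2 ⟨h4, by omega, by omega⟩
        · rcases Finset.mem_insert.1 hx with rfl | hx' <;>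
            rcases Finset.mem_insert.1 hy with rfl | hy
          · omega
          · have := hin y hy
            omega
          · have := mem_live.1 (hS hx')
            omega
          · exact hN x hx' y hy hxy
      rw [Finset.card_insert_of_notMem heS, hcard, ← hconst f.2 h1 le_rfl] at this
      unfold nest at this
      omega
    · exact (nest_succ_of_not_mem hO hC).symm

end

/-! ### Matchings without triple crossings correspond to profiles -/

/-- Induction on the number of edges: the last opener `p` is joined to the end `q` of its peak, and
this edge is added to an edge set of the lowered profile. `nest_insert` turns the lowered sequence
back into `ℓ`. -/
theorem exists_edgeSet {O C : Finset ℕ} {ℓ : ℕ → ℕ} (h : IsProfile O C ℓ) :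
    ∃ E, IsEdgeSet E ∧ NoTripleCrossing E ∧ E.image Prod.fst = O ∧ E.image Prod.snd = C ∧
      ∀ t, nest E t = ℓ t := by
  induction hn : O.card generalizing O C ℓ with
  | zero =>
    have hO : O = ∅ := Finset.card_eq_zero.1 hn
    have hC : C = ∅ := Finset.card_eq_zero.1 (h.card_eq ▸ hn)
    subst hO hC
    refine ⟨∅, ⟨by simp, by simp, by simp, by simp⟩, by simp [NoTripleCrossing], by simp,
      by simp, fun t => ?_⟩
    have := h.le_height t
    simp only [countBelow, Finset.filter_empty, Finset.card_empty] at this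
    rw [nest, live, Finset.filter_empty, nestNum_empty]
    omega
  | succ n ih =>
    have hne : O.Nonempty := Finset.card_pos.1 (by omega)
    set p := O.max' hne with hp_def
    have hpO : p ∈ O := O.max'_mem hne
    have hp : ∀ x ∈ O, x ≤ p := fun x hx => O.le_max' x hx
    obtain ⟨f, q, hk⟩ := h.exists_peak hpO hp
    obtain ⟨E, hE, h3, hO, hC, hℓ⟩ := ih (h.lowered hpO hp hk)
      (by rw [Finset.card_erase_of_mem hpO]; omega)
    have hpC := h.disj p hpO
    have hqO : q ∉ O := fun hq => h.disj q hq hk.q_mem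
    obtain ⟨k1, k2, k3, k4, k5, k6, k7, k8⟩ := hk
    have hfst : ∀ e ∈ E, e.1 ∈ O ∧ e.1 ≠ p := fun e he => by
      have : e.1 ∈ O.erase p := hO ▸ Finset.mem_image_of_mem _ he
      exact (Finset.mem_erase.1 this).symm
    have hsnd : ∀ e ∈ E, e.2 ∈ C ∧ e.2 ≠ q := fun e he => by
      have : e.2 ∈ C.erase q := hC ▸ Finset.mem_image_of_mem _ he
      exact (Finset.mem_erase.1 this).symm
    have hlt : ∀ e ∈ E, e.1 < p := fun e he => by
      have := hfst e he
      have := hp e.1 this.1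
      omega
    have hpos : ∀ t, f < t → t ≤ q → ℓ t = ℓ (q + 1) + 1 := fun t h1 h2 => by
      rw [k7 t h1 h2, ← k7 q k2 le_rfl, k8]
    refine ⟨insert (p, q) E, hE.insert_edge (by omega)
      (fun e he => ⟨(hfst e he).2, fun h => hqO (h ▸ (hfst e he).1)⟩)
      (fun e he => ⟨fun h => hpC (h ▸ (hsnd e he).1), (hsnd e he).2⟩), ?_, ?_, ?_, ?_⟩
    · have hdf : ∀ e ∈ E, ∀ g ∈ E, p < e.2 → e.2 < g.2 → g.2 < q →
          nest E g.2 = nest E (g.2 + 1) + 1 → nest E e.2 = nest E (e.2 + 1) + 1 := by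
        intro e he g hg h1 h2 h3 h4
        -- Between `f` and `q` the lowered sequence is constant, so a down step before `q` cannot
        -- come after `f`; before `f` all closers are down steps.
        have hgf : g.2 ≤ f := by
          by_contra hc
          have a1 := hpos g.2 (by omega) (by omega)
          have a2 := hpos (g.2 + 1) (by omega) (by omega)
          rw [hℓ, hℓ] at h4
          unfold lowered at h4
          rw [if_pos (by omega), if_pos (by omega)] at h4
          omega
        have := k6 e.2 (hsnd e he).1 h1 (by omega)
        rw [hℓ, hℓ, lowered, lowered, if_neg (by omega), if_neg (by omega), this]
      intro a ha b hb c hc h1 h2 h4 h5 h6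
      have hle : ∀ x ∈ insert (p, q) E, x.1 ≤ p := fun x hx => by
        rcases Finset.mem_insert.1 hx with rfl | hx
        exacts [le_rfl, (hlt x hx).le]
      have hcp := hle c hc
      -- The new edge has the last opener, so it can only be the third edge of a triple crossing;
      -- then the other two would cross and both close in `(p, q)`.
      have ha' : a ∈ E := (Finset.mem_insert.1 ha).resolve_left fun h => by
        rw [h] at h1; simp only at h1; omega
      have hb' : b ∈ E := (Finset.mem_insert.1 hb).resolve_left fun h => by
        rw [h] at h2; simp only at h2; omega
      rcases Finset.mem_insert.1 hc with rfl | hc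
      · have := hE.nested_of_down_flat h3 hlt hdf ha' hb' h4 h5 h6
        omega
      · exact h3 a ha' b hb' c hc h1 h2 h4 h5 h6
    · rw [Finset.image_insert, hO, Finset.insert_erase hpO]
    · rw [Finset.image_insert, hC, Finset.insert_erase k3]
    · intro t
      rw [nest_insert hlt, hℓ, hℓ]
      have hanti := h.antitone hp (s := t) (t := f)
      have h9 : f ≠ p → ℓ f = ℓ (q + 1) + 1 := fun hf => by
        rw [← (k5 hf).2.2, hpos (f + 1) (by omega) (by omega)]
      have hq1 : lowered ℓ f q (q + 1) = ℓ (q + 1) := if_neg (by omega)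
      rw [hq1]
      unfold lowered
      by_cases h1 : f < t ∧ t ≤ q
      · have := hpos t h1.1 h1.2
        rw [if_pos ⟨k1.trans_lt h1.1, h1.2⟩, if_pos h1]
        omega
      · rw [if_neg h1]
        split_ifs with h2
        · have := h9 (by omega)
          have := hanti h2.1 (by omega)
          omega
        · rfl

/-- By `nest_insert`, the edge `(p, q)` raises the nesting number of the other edges exactly where
the latter has already fallen to its value after `q`, which happens on an interval `(f, q]`. The
absence of triple crossings makes the other edges closing in `(p, q)` nested, so by
`IsEdgeSet.flat_of_flat` every closer before `f` is a down step. -/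
theorem IsEdgeSet.isPeak {E : Finset (ℕ × ℕ)} (hE : IsEdgeSet E) (h3 : NoTripleCrossing E)
    {p q : ℕ} (hpq : (p, q) ∈ E) (hp : ∀ e ∈ E, e.1 ≤ p) :
    ∃ f, IsPeak (E.image Prod.snd) (nest E) p f q ∧
      ∀ t, nest (E.erase (p, q)) t = lowered (nest E) f q t := by
  classical
  set F := E.erase (p, q) with hF_def
  have hEF : E = insert (p, q) F := (Finset.insert_erase hpq).symm
  have hF : IsEdgeSet F := hE.mono (Finset.erase_subset _ _)
  have hFE : ∀ e ∈ F, e ∈ E ∧ e ≠ (p, q) := fun e he => (Finset.mem_erase.1 he).symm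
  have hlt : ∀ e ∈ F, e.1 < p := fun e he => by
    have h1 := hp e (hFE e he).1
    have h2 : e.1 ≠ p := fun h => (hFE e he).2 (hE.fst_inj e (hFE e he).1 _ hpq h)
    omega
  have hsq : ∀ e ∈ F, e.2 ≠ q := fun e he h =>
    (hFE e he).2 (hE.snd_inj e (hFE e he).1 _ hpq h)
  have hsp : ∀ e ∈ F, e.2 ≠ p := fun e he h =>
    hE.fst_ne_snd _ hpq e (hFE e he).1 h.symm
  have hpq' : p < q := hE.lt _ hpq
  have hO : ∀ t, p ≤ t → t ∉ F.image Prod.fst := fun t ht h => by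
    obtain ⟨e, he, h⟩ := Finset.mem_image.1 h
    have := hlt e he
    omega
  have hn : ∀ e ∈ F, ∀ f ∈ F, p < e.2 → e.2 < f.2 → f.2 < q → f.1 < e.1 := by
    intro e he f hf h1 h2 h4
    by_contra hc
    have h5 : e.1 ≠ f.1 := fun h => by rw [hF.fst_inj e he f hf h] at h2; omega
    exact h3 e (hFE e he).1 f (hFE f hf).1 (p, q) hpq (by omega) (hlt f hf) h1 h2 h4
  have hnest := nest_insert (q := q) hlt
  rw [← hEF] at hnest
  have hqq : nest F (q + 1) = nest F q := nest_succ_of_not_mem (hO q hpq'.le) fun h => by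
    obtain ⟨e, he, h⟩ := Finset.mem_image.1 h
    exact hsq e he h
  have hpp : nest F (p + 1) = nest F p := nest_succ_of_not_mem (hO p le_rfl) fun h => by
    obtain ⟨e, he, h⟩ := Finset.mem_image.1 h
    exact hsp e he h
  have hanti : ∀ s t, p < s → s ≤ t → nest F t ≤ nest F s := fun s t h1 h2 =>
    nest_antitone (fun e he => (hlt e he).le) h1 h2
  -- After this `f`, the term `nest F (q + 1) + 1` wins the maximum in `nest_insert`.
  have hex : ∃ f, p ≤ f ∧ nest F (f + 1) ≤ nest F (q + 1) := ⟨q, hpq'.le, le_rfl⟩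
  obtain ⟨f1, f2⟩ := Nat.find_spec hex
  have hmin := fun t (ht : t < Nat.find hex) => Nat.find_min hex ht
  have hfq : Nat.find hex < q := by
    have := Nat.find_min' hex (m := q - 1) ⟨by omega, by
      rw [show q - 1 + 1 = q by omega, hqq]⟩
    omega
  set f := Nat.find hex
  have hflat : ∀ t, f < t → t ≤ q + 1 → nest F t = nest F (q + 1) := fun t h1 h2 => by
    have a1 := hanti t (q + 1) (by omega) h2
    have a2 := hanti (f + 1) t (by omega) (by omega)
    omega
  have hhigh : ∀ t, p < t → t ≤ f → nest F (q + 1) + 1 ≤ nest F t := fun t h1 h2 => by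
    have := hmin (t - 1) (by omega)
    rw [show t - 1 + 1 = t by omega] at this
    omega
  have hL1 : ∀ t, f < t → t ≤ q → nest E t = nest F (q + 1) + 1 := fun t h1 h2 => by
    rw [hnest, if_pos (by omega), hflat t h1 (by omega)]
    omega
  have hL2 : ∀ t, t ≤ f → nest E t = nest F t := fun t h1 => by
    rw [hnest]
    split_ifs with h
    · have := hhigh t h.1 h1
      omega
    · rfl
  have hL3 : ∀ t, q < t → nest E t = nest F t := fun t h1 => by
    rw [hnest, if_neg (by omega)]
  have hf_ne : f ≠ p → f ∈ F.image Prod.snd ∧ nest F f = nest F (q + 1) + 1 := fun hfp => by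
    have h1 := hhigh f (by omega) le_rfl
    have h2 : f ∈ F.image Prod.snd := by
      by_contra hC
      have := nest_succ_of_not_mem (hO f f1) hC
      omega
    have := hF.nest_snd h2
    have := hflat (f + 1) (by omega) (by omega)
    exact ⟨h2, by omega⟩
  refine ⟨f, ⟨f1, hfq, Finset.mem_image_of_mem _ hpq, ?_, ?_, ?_, ?_, ?_⟩, ?_⟩
  · intro h
    have := hflat (p + 1) (by omega) (by omega)
    rw [hL1 (p + 1) (by omega) (by omega), hL2 p (by omega)]
    omega
  · intro h
    obtain ⟨h1, h2⟩ := hf_ne h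
    refine ⟨?_, ?_, ?_⟩
    · rw [hL2 _ (by omega), hL2 _ (by omega), hpp]
    · exact Finset.image_subset_image (Finset.erase_subset _ _) h1
    · rw [hL1 _ (by omega) (by omega), hL2 _ le_rfl, h2]
  · intro c hc h1 h2
    obtain ⟨e, he, rfl⟩ := Finset.mem_image.1 hc
    have heF : e ∈ F := Finset.mem_erase.2 ⟨fun h => by rw [h] at h2; simp only at h2; omega, he⟩
    rw [hL2 _ (by omega), hL2 _ (by omega)]
    refine (hF.nest_snd (Finset.mem_image_of_mem _ heF)).resolve_left fun hfl => ?_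
    have h5 := hF.flat_of_flat hlt hn heF h1 hfl f (by omega) hfq
    have h6 := hf_ne (by omega)
    have := hflat (f + 1) (by omega) (by omega)
    omega
  · intro t h1 h2
    rw [hL1 t h1 h2, hL1 (f + 1) (by omega) (by omega)]
  · rw [hL1 q hfq le_rfl, hL3 _ (by omega)]
  · intro t
    unfold lowered
    split_ifs with h
    · rw [hL1 t h.1 h.2, hflat t h.1 (by omega)]
      omega
    · by_cases h1 : t ≤ f
      · rw [hL2 t h1]
      · rw [hL3 t (by omega)]

/-- The peak is determined by the openers, the closers and the nesting numbers, so both sets have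
the same edge at the last opener. Deleting it changes the nesting numbers in the same way. -/
theorem edgeSet_unique {E F : Finset (ℕ × ℕ)} (hE : IsEdgeSet E) (hF : IsEdgeSet F)
    (hE3 : NoTripleCrossing E) (hF3 : NoTripleCrossing F)
    (hO : E.image Prod.fst = F.image Prod.fst) (hC : E.image Prod.snd = F.image Prod.snd)
    (hℓ : ∀ t, nest E t = nest F t) : E = F := by
  induction hn : E.card generalizing E F with
  | zero =>
    obtain rfl := Finset.card_eq_zero.1 hn
    rw [Finset.image_empty, eq_comm, Finset.image_eq_empty] at hO
    exact hO.symm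
  | succ n ih =>
    have hne : (E.image Prod.fst).Nonempty := (Finset.card_pos.1 (by omega)).image _
    obtain ⟨⟨p, q⟩, hpq, hp1⟩ := Finset.mem_image.1 (Finset.max'_mem _ hne)
    have hmax := Finset.max'_mem _ hne
    obtain ⟨⟨p', q'⟩, hpq', hp1'⟩ := Finset.mem_image.1 ((Finset.ext_iff.1 hO _).1 hmax)
    have hp : ∀ x ∈ E.image Prod.fst, x ≤ p := fun x hx =>
      (Finset.le_max' _ x hx).trans_eq hp1.symm
    obtain rfl : p = p' := hp1.trans hp1'.symm
    obtain ⟨f, hk, hl⟩ := hE.isPeak hE3 hpq fun e he => hp _ (Finset.mem_image_of_mem _ he)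
    obtain ⟨f', hk', hl'⟩ := hF.isPeak hF3 hpq' fun e he =>
      hp _ (hO ▸ Finset.mem_image_of_mem _ he)
    rw [← hC, ← funext hℓ] at hk'
    obtain ⟨rfl, rfl⟩ := hk.unique hk'
    have himg1 : ∀ {G : Finset (ℕ × ℕ)}, IsEdgeSet G → (p, q) ∈ G →
        (G.erase (p, q)).image Prod.fst = (G.image Prod.fst).erase p := fun {G} hG hm => by
      ext x
      simp only [Finset.mem_image, Finset.mem_erase]
      constructor
      · rintro ⟨e, ⟨h1, h2⟩, rfl⟩
        exact ⟨fun h => h1 (hG.fst_inj e h2 _ hm h), e, h2, rfl⟩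
      · rintro ⟨h1, e, h2, rfl⟩
        exact ⟨e, ⟨fun h => h1 (by rw [h]), h2⟩, rfl⟩
    have himg2 : ∀ {G : Finset (ℕ × ℕ)}, IsEdgeSet G → (p, q) ∈ G →
        (G.erase (p, q)).image Prod.snd = (G.image Prod.snd).erase q := fun {G} hG hm => by
      ext x
      simp only [Finset.mem_image, Finset.mem_erase]
      constructor
      · rintro ⟨e, ⟨h1, h2⟩, rfl⟩
        exact ⟨fun h => h1 (hG.snd_inj e h2 _ hm h), e, h2, rfl⟩
      · rintro ⟨h1, e, h2, rfl⟩
        exact ⟨e, ⟨fun h => h1 (by rw [h]), h2⟩, rfl⟩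
    have := ih (hE.mono (Finset.erase_subset (p, q) _)) (hF.mono (Finset.erase_subset (p, q) _))
      (hE3.mono (Finset.erase_subset _ _)) (hF3.mono (Finset.erase_subset _ _))
      (by rw [himg1 hE hpq, himg1 hF hpq', hO]) (by rw [himg2 hE hpq, himg2 hF hpq', hC])
      (fun t => by rw [hl, hl', funext hℓ]) (by rw [Finset.card_erase_of_mem hpq]; omega)
    rw [← Finset.insert_erase hpq, this, Finset.insert_erase hpq']

/-! ### Noncrossing matchings -/

/-- No two edges cross. -/
def Noncrossing (E : Finset (ℕ × ℕ)) : Prop :=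
  ∀ e ∈ E, ∀ f ∈ E, e.1 < f.1 → f.1 < e.2 → ¬ e.2 < f.2

theorem Noncrossing.noTripleCrossing {E : Finset (ℕ × ℕ)} (h : Noncrossing E) :
    NoTripleCrossing E :=
  fun e he f hf _ _ h1 h2 h3 h4 _ => h e he f hf h1 (h2.trans h3) h4

theorem Noncrossing.nest_eq {E : Finset (ℕ × ℕ)} (hE : IsEdgeSet E) (h : Noncrossing E) (t : ℕ) :
    nest E t = countBelow (E.image Prod.fst) t - countBelow (E.image Prod.snd) t := by
  rw [hE.card_live t, nest, Nested.nestNum_eq, Nat.add_sub_cancel]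
  intro e he f hf hlt
  rw [mem_live] at he hf
  have h1 := h e he.1 f hf.1 hlt (by omega)
  have : e.2 ≠ f.2 := fun h => by rw [hE.snd_inj e he.1 f hf.1 h] at hlt; omega
  omega

theorem noncrossing_unique {E F : Finset (ℕ × ℕ)} (hE : IsEdgeSet E) (hF : IsEdgeSet F)
    (hE2 : Noncrossing E) (hF2 : Noncrossing F)
    (hO : E.image Prod.fst = F.image Prod.fst) (hC : E.image Prod.snd = F.image Prod.snd) :
    E = F :=
  edgeSet_unique hE hF hE2.noTripleCrossing hF2.noTripleCrossing hO hC fun t => by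
    rw [hE2.nest_eq hE, hF2.nest_eq hF, hO, hC]

/-- This is the extreme profile `ℓ = h`. Where the nesting number equals the number of live edges,
these are nested; two crossing edges would both be live where the first one closes. -/
theorem exists_noncrossing {O C : Finset ℕ} (hd : ∀ t ∈ O, t ∉ C) (hcard : O.card = C.card)
    (hle : ∀ t, countBelow C t ≤ countBelow O t) :
    ∃ E, IsEdgeSet E ∧ Noncrossing E ∧ E.image Prod.fst = O ∧ E.image Prod.snd = C := by
  have hp : IsProfile O C (fun t => countBelow O t - countBelow C t) := by
    refine ⟨hd, hcard, by simp [countBelow_zero], ?_, ?_, ?_, ?_, ?_⟩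
    · intro t ht
      have h1 := countBelow_succ O t
      have h2 := countBelow_succ C t
      have h3 := hle t
      rw [if_pos ht] at h1
      rw [if_neg (hd t ht)] at h2
      omega
    · intro t ht
      have h1 := countBelow_succ O t
      have h2 := countBelow_succ C t
      have h3 := hle t
      have h4 := hle (t + 1)
      rw [if_neg fun h => hd t h ht] at h1
      rw [if_pos ht] at h2
      omega
    · intro t h1 h2
      simp only [countBelow_succ, if_neg h1, if_neg h2, add_zero]
    · intro t
      have := hle t
      omega
    · intro t
      have := hle t
      omega
  obtain ⟨E, hE, -, hO, hC, hn⟩ := exists_edgeSet hp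
  refine ⟨E, hE, fun e he f hf h1 h2 h3 => ?_, hO, hC⟩
  have h4 := hE.card_live e.2
  rw [hO, hC] at h4
  have h5 := hn e.2
  have := nested_of_nestNum_eq (S := live E e.2) (by rw [nest] at h5; omega) e
    (mem_live.2 ⟨he, hE.lt e he, le_rfl⟩) f (mem_live.2 ⟨hf, h2, h3.le⟩) h1
  omega

/-! ### Words -/

/-- The positions of the step `s` in the word `w`. -/
def positions (s : DyckStep) (w : List DyckStep) : Finset ℕ :=
  (Finset.range w.length).filter (fun v => w[v]? = some s)

theorem mem_positions {s : DyckStep} {w : List DyckStep} {v : ℕ} :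
    v ∈ positions s w ↔ w[v]? = some s := by
  simp only [positions, Finset.mem_filter, Finset.mem_range, and_iff_right_iff_imp]
  intro h
  exact (List.getElem?_eq_some_iff.1 h).1

theorem lt_length_of_mem_positions {s : DyckStep} {w : List DyckStep} {v : ℕ}
    (h : v ∈ positions s w) : v < w.length := by
  simpa using Finset.mem_of_mem_filter v h

theorem count_take (s : DyckStep) (w : List DyckStep) (t : ℕ) :
    (w.take t).count s = countBelow (positions s w) t := by
  induction t with
  | zero => simp [countBelow_zero]
  | succ t ih =>
    rw [List.take_add_one, List.count_append, ih, countBelow_succ]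
    simp only [mem_positions]
    congr 1
    cases w[t]? with
    | none => simp
    | some a => simp [List.count_singleton]

theorem count_drop (s : DyckStep) (w : List DyckStep) (t : ℕ) :
    (w.drop t).count s = ((positions s w).filter (t ≤ ·)).card := by
  have h1 := count_take s w t
  have h2 := count_take s w w.length
  rw [List.take_length, countBelow_eq_card fun x hx => lt_length_of_mem_positions hx] at h2
  have h3 : w.count s = (w.take t).count s + (w.drop t).count s := by
    rw [← List.count_append, List.take_append_drop]
  have h4 := Finset.card_filter_add_card_filter_not (s := positions s w) (t ≤ ·)
  simp only [not_le] at h4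
  unfold countBelow at h1
  omega

theorem height_eq (w : List DyckStep) (t : ℕ) :
    height w t =
      (countBelow (positions DyckStep.U w) t : ℤ) - countBelow (positions DyckStep.D w) t := by
  rw [height, count_take, count_take]

theorem vertex_eq (w : List DyckStep) (t : ℕ) :
    vertex w t = (countBelow (positions DyckStep.U w) t,
      ((positions DyckStep.D w).filter (t ≤ ·)).card) := by
  rw [vertex, count_take, count_drop]

theorem height_zero (w : List DyckStep) : height w 0 = 0 := by
  simp [height]

theorem height_succ {w : List DyckStep} {t : ℕ} (h : t < w.length) :
    height w (t + 1) = height w t + if w[t] = DyckStep.U then 1 else -1 := by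
  rw [height_eq, height_eq, countBelow_succ, countBelow_succ]
  simp only [mem_positions, List.getElem?_eq_getElem h, Option.some.injEq]
  rcases w[t].dichotomy with h1 | h1 <;> simp [h1] <;> ring

theorem height_of_length_le {w : List DyckStep} {t : ℕ} (h : w.length ≤ t) :
    height w t = height w w.length := by
  rw [height, height, List.take_of_length_le h, List.take_length]

theorem ext_height {w w' : List DyckStep} (hl : w.length = w'.length)
    (h : ∀ t ≤ w.length, height w t = height w' t) : w = w' := by
  refine List.ext_getElem hl fun t h1 h2 => ?_
  have a := height_succ h1
  have b := height_succ h2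
  rw [h t h1.le, h (t + 1) h1] at a
  rw [a] at b
  rcases w[t].dichotomy with h3 | h3 <;> rcases w'[t].dichotomy with h4 | h4 <;>
    simp_all

theorem height_length (w : DyckWord) : height w.toList w.toList.length = 0 := by
  rw [height, List.take_length, w.count_U_eq_count_D, sub_self]

theorem height_nonneg (w : DyckWord) (t : ℕ) : 0 ≤ height w.toList t := by
  have := w.count_D_le_count_U t
  unfold height
  omega

theorem length_eq (w : DyckWord) : w.toList.length = 2 * w.semilength :=
  w.two_mul_semilength_eq_length.symm

theorem height_eq_of_semilength {w : DyckWord} {N : ℕ} (hw : w.semilength = N) {t : ℕ}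
    (ht : 2 * N ≤ t) : height w.toList t = 0 := by
  rw [height_of_length_le (by rw [length_eq, hw]; exact ht), height_length]

theorem dyckWord_ext {w w' : DyckWord} (hs : w.semilength = w'.semilength)
    (h : ∀ t ≤ 2 * w.semilength, height w.toList t = height w'.toList t) : w = w' :=
  DyckWord.ext (ext_height (by rw [length_eq, length_eq, hs]) fun t ht =>
    h t (by rwa [length_eq] at ht))

theorem exists_dyckWord {N : ℕ} {b : ℕ → ℤ} (h0 : b 0 = 0)
    (hs : ∀ t < 2 * N, b (t + 1) = b t + 1 ∨ b (t + 1) = b t - 1) (hn : ∀ t ≤ 2 * N, 0 ≤ b t)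
    (hN : b (2 * N) = 0) :
    ∃ w : DyckWord, w.semilength = N ∧ ∀ t ≤ 2 * N, height w.toList t = b t := by
  set l : List DyckStep := List.ofFn (fun v : Fin (2 * N) =>
    if b (v + 1) = b v + 1 then DyckStep.U else DyckStep.D) with hl
  have hlen : l.length = 2 * N := List.length_ofFn
  have hh : ∀ t ≤ 2 * N, height l t = b t := by
    intro t
    induction t with
    | zero => intro; rw [height_zero, h0]
    | succ t ih =>
      intro ht
      rw [height_succ (by omega), ih (by omega)]
      simp only [hl, List.getElem_ofFn]
      have := hs t (by omega)
      by_cases h : b (t + 1) = b t + 1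
      · simp [h]
      · simp only [h, if_false, reduceCtorEq]
        omega
  have hfin := hh (2 * N) le_rfl
  rw [hN, height, List.take_of_length_le hlen.le] at hfin
  have heq : l.count DyckStep.U = l.count DyckStep.D := by omega
  let w : DyckWord := ⟨l, heq, fun i => by
    by_cases hi : i ≤ 2 * N
    · have h1 := hh i hi
      have h2 := hn i hi
      unfold height at h1
      omega
    · rw [List.take_of_length_le (by omega), heq]⟩
  refine ⟨w, ?_, hh⟩
  have := length_eq w
  change l.length = _ at this
  omega

/-- Only `k` steps remain after step `2n + k`, so a descent from height `k` to `0` leaves no room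
for an east step. -/
theorem suffix_iff_height {w : DyckWord} {n k : ℕ} (hw : w.semilength = n + k) :
    List.replicate k DyckStep.D <:+ w.toList ↔ height w.toList (2 * n + k) = k := by
  have hlen := length_eq w
  have hfin := w.count_U_eq_count_D
  constructor
  · rintro ⟨l, hl⟩
    have h1 : l.length = 2 * n + k := by
      rw [← hl, List.length_append, List.length_replicate] at hlen
      omega
    rw [← hl, List.count_append, List.count_append, List.count_replicate,
      List.count_replicate] at hfin
    rw [height, ← hl, List.take_left' h1]
    simp at hfin
    omega
  · intro h
    have h1 : ∀ s, w.toList.count s =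
        (w.toList.take (2 * n + k)).count s + (w.toList.drop (2 * n + k)).count s := fun s => by
      rw [← List.count_append, List.take_append_drop]
    have h2 := h1 DyckStep.U
    have h3 := h1 DyckStep.D
    have h4 : (w.toList.drop (2 * n + k)).length = k := by
      rw [List.length_drop]
      omega
    have h5 : (w.toList.drop (2 * n + k)).count DyckStep.D ≤ k :=
      List.count_le_length.trans_eq h4
    unfold height at h
    have h6 : (w.toList.drop (2 * n + k)).count DyckStep.D =
        (w.toList.drop (2 * n + k)).length := by omega
    have h7 : w.toList.drop (2 * n + k) = List.replicate k DyckStep.D :=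
      List.eq_replicate_iff.2 ⟨h4, fun b hb => (List.count_eq_length.1 h6 b hb).symm⟩
    exact h7 ▸ List.drop_suffix _ _

theorem positions_disjoint {w : List DyckStep} {t : ℕ} (h : t ∈ positions DyckStep.U w) :
    t ∉ positions DyckStep.D w := by
  rw [mem_positions] at h ⊢
  simp [h]

theorem mem_positions_or {w : List DyckStep} {t : ℕ} (h : t < w.length) :
    t ∈ positions DyckStep.U w ∨ t ∈ positions DyckStep.D w := by
  simp only [mem_positions, List.getElem?_eq_getElem h, Option.some.injEq]
  exact w[t].dichotomy

theorem card_positions (s : DyckStep) (w : DyckWord) :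
    (positions s w.toList).card = w.semilength := by
  have h := count_take s w.toList w.toList.length
  rw [List.take_length, countBelow_eq_card fun x hx => lt_length_of_mem_positions hx] at h
  rw [← h]
  rcases s.dichotomy with rfl | rfl
  · rfl
  · exact w.count_U_eq_count_D.symm

/-! ### The edges of a matching -/

section

variable {m : ℕ}

/-- The pairs of a matching, the smaller element first. -/
def edges (P : Matching m) : Finset (ℕ × ℕ) :=
  (Finset.univ.filter (fun v => v < P.partner v)).image
    (fun v : Fin m => ((v : ℕ), (P.partner v : ℕ)))

theorem mem_edges {P : Matching m} {e : ℕ × ℕ} :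
    e ∈ edges P ↔ ∃ v, v < P.partner v ∧ ((v : ℕ), (P.partner v : ℕ)) = e := by
  simp [edges]

theorem mk_mem_edges {P : Matching m} {u v : Fin m} :
    ((u : ℕ), (v : ℕ)) ∈ edges P ↔ u < v ∧ P.partner u = v := by
  rw [mem_edges]
  constructor
  · rintro ⟨w, h, e⟩
    simp only [Prod.mk.injEq, Fin.val_inj] at e
    obtain ⟨rfl, rfl⟩ := e
    exact ⟨h, rfl⟩
  · rintro ⟨h, rfl⟩
    exact ⟨u, h, rfl⟩

theorem exists_of_mem_edges {P : Matching m} {e : ℕ × ℕ} (h : e ∈ edges P) :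
    ∃ u v : Fin m, e = ((u : ℕ), (v : ℕ)) ∧ u < v ∧ P.partner u = v ∧ P.partner v = u := by
  obtain ⟨v, h1, rfl⟩ := mem_edges.1 h
  exact ⟨v, P.partner v, rfl, h1, rfl, P.involutive v⟩

theorem isEdgeSet_edges (P : Matching m) : IsEdgeSet (edges P) where
  lt e he := by
    obtain ⟨u, v, rfl, h, -⟩ := exists_of_mem_edges he
    exact h
  fst_inj e he f hf h := by
    obtain ⟨u, v, rfl, -, h1, -⟩ := exists_of_mem_edges he
    obtain ⟨u', v', rfl, -, h2, -⟩ := exists_of_mem_edges hf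
    obtain rfl : u = u' := Fin.ext h
    rw [← h1, ← h2]
  snd_inj e he f hf h := by
    obtain ⟨u, v, rfl, -, -, h1⟩ := exists_of_mem_edges he
    obtain ⟨u', v', rfl, -, -, h2⟩ := exists_of_mem_edges hf
    obtain rfl : v = v' := Fin.ext h
    rw [← h1, ← h2]
  fst_ne_snd e he f hf h := by
    obtain ⟨u, v, rfl, h3, h1, -⟩ := exists_of_mem_edges he
    obtain ⟨u', v', rfl, h4, -, h2⟩ := exists_of_mem_edges hf
    obtain rfl : u = v' := Fin.ext h
    rw [h1] at h2
    subst h2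
    exact absurd (h3.trans h4) (lt_irrefl _)

theorem edges_injective {P Q : Matching m} (h : edges P = edges Q) : P = Q := by
  ext v
  rcases lt_trichotomy v (P.partner v) with h1 | h1 | h1
  · have := (mk_mem_edges (P := P)).2 ⟨h1, rfl⟩
    rw [h, mk_mem_edges] at this
    rw [this.2]
  · rcases lt_trichotomy v (Q.partner v) with h2 | h2 | h2
    · have := (mk_mem_edges (P := Q)).2 ⟨h2, rfl⟩
      rw [← h, mk_mem_edges] at this
      rw [this.2]
    · rw [← h1, ← h2]
    · have := (mk_mem_edges (P := Q)).2 ⟨h2, Q.involutive v⟩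
      rw [← h, mk_mem_edges] at this
      have h3 := P.involutive (Q.partner v)
      rw [this.2] at h3
      rw [h3]
  · have := (mk_mem_edges (P := P)).2 ⟨h1, P.involutive v⟩
    rw [h, mk_mem_edges] at this
    have h3 := Q.involutive (P.partner v)
    rw [this.2] at h3
    rw [h3]

theorem exists_matching {E : Finset (ℕ × ℕ)} (hE : IsEdgeSet E) (hm : ∀ e ∈ E, e.2 < m) :
    ∃ P : Matching m, edges P = E := by
  classical
  let r : Fin m → Fin m → Prop := fun u v => ((u : ℕ), (v : ℕ)) ∈ E ∨ ((v : ℕ), (u : ℕ)) ∈ E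
  have hsymm : ∀ u v, r u v → r v u := fun u v h => h.symm
  have huniq : ∀ u v w, r u v → r u w → v = w := by
    rintro u v w (h1 | h1) (h2 | h2)
    · exact Fin.ext (Prod.ext_iff.1 (hE.fst_inj _ h1 _ h2 rfl)).2
    · exact absurd rfl (hE.fst_ne_snd _ h1 _ h2)
    · exact absurd rfl (hE.fst_ne_snd _ h2 _ h1)
    · exact Fin.ext (Prod.ext_iff.1 (hE.snd_inj _ h1 _ h2 rfl)).1
  let g : Fin m → Fin m := fun u => if h : ∃ v, r u v then h.choose else u
  have hg : ∀ u v, r u v → g u = v := fun u v h => by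
    have hex : ∃ v, r u v := ⟨v, h⟩
    have : g u = hex.choose := dif_pos hex
    rw [this]
    exact huniq u _ _ hex.choose_spec h
  have hg' : ∀ u, g u ≠ u → r u (g u) := fun u h => by
    by_cases hex : ∃ v, r u v
    · obtain ⟨v, hv⟩ := hex
      rwa [hg u v hv]
    · exact absurd (dif_neg hex) h
  refine ⟨⟨g, fun u => ?_⟩, ?_⟩
  · by_cases h : g u = u
    · rw [h, h]
    · exact hg _ _ (hsymm _ _ (hg' u h))
  · ext ⟨a, b⟩
    constructor
    · intro h
      obtain ⟨u, v, h1, h2, h3, -⟩ := exists_of_mem_edges h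
      rw [h1]
      simp only at h3
      subst h3
      exact (hg' u h2.ne').resolve_right fun h => by
        have := hE.lt _ h
        exact absurd (h2.trans this) (lt_irrefl _)
    · intro h
      have h1 := hE.lt _ h
      have h2 := hm _ h
      simp only at h1 h2
      have := (mk_mem_edges (P := ⟨g, fun u => by
        by_cases h : g u = u
        · rw [h, h]
        · exact hg _ _ (hsymm _ _ (hg' u h))⟩) (u := ⟨a, h1.trans h2⟩) (v := ⟨b, h2⟩)).2
        ⟨h1, hg _ _ (Or.inl h)⟩
      exact this

theorem mem_openers {P : Matching m} {t : ℕ} :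
    t ∈ (edges P).image Prod.fst ↔ ∃ h : t < m, (⟨t, h⟩ : Fin m) < P.partner ⟨t, h⟩ := by
  rw [Finset.mem_image]
  constructor
  · rintro ⟨e, he, rfl⟩
    obtain ⟨u, v, rfl, h, rfl, -⟩ := exists_of_mem_edges he
    exact ⟨u.2, h⟩
  · rintro ⟨h, h1⟩
    exact ⟨_, mem_edges.2 ⟨_, h1, rfl⟩, rfl⟩

theorem mem_closers {P : Matching m} {t : ℕ} :
    t ∈ (edges P).image Prod.snd ↔ ∃ h : t < m, P.partner ⟨t, h⟩ < (⟨t, h⟩ : Fin m) := by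
  rw [Finset.mem_image]
  constructor
  · rintro ⟨e, he, rfl⟩
    obtain ⟨u, v, rfl, h, -, rfl⟩ := exists_of_mem_edges he
    exact ⟨v.2, h⟩
  · rintro ⟨h, h1⟩
    exact ⟨(_, t), mk_mem_edges.2 ⟨h1, P.involutive ⟨t, h⟩⟩, rfl⟩

theorem border_length (P : Matching m) : (border P).length = m := by simp [border]

theorem border_getElem (P : Matching m) {t : ℕ} (h : t < (border P).length) :
    (border P)[t] = if (⟨t, by rwa [border_length] at h⟩ : Fin m) <
      P.partner ⟨t, by rwa [border_length] at h⟩ then DyckStep.U else DyckStep.D := by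
  simp [border]

theorem positions_U_border (P : Matching m) :
    positions DyckStep.U (border P) = (edges P).image Prod.fst := by
  ext t
  rw [mem_positions, mem_openers, List.getElem?_eq_some_iff]
  constructor
  · rintro ⟨h1, h2⟩
    rw [border_getElem] at h2
    refine ⟨by rwa [border_length] at h1, ?_⟩
    by_contra h3
    rw [if_neg h3] at h2
    cases h2
  · rintro ⟨h1, h2⟩
    refine ⟨by rwa [border_length], ?_⟩
    rw [border_getElem, if_pos h2]

theorem positions_D_border {P : Matching m} (hP : ∀ v, P.partner v ≠ v) :
    positions DyckStep.D (border P) = (edges P).image Prod.snd := by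
  ext t
  rw [mem_positions, mem_closers, List.getElem?_eq_some_iff]
  constructor
  · rintro ⟨h1, h2⟩
    rw [border_getElem] at h2
    have h3 : t < m := by rwa [border_length] at h1
    refine ⟨h3, ?_⟩
    by_contra h4
    rw [if_pos (lt_of_le_of_ne (not_lt.1 h4) (hP _).symm)] at h2
    cases h2
  · rintro ⟨h1, h2⟩
    refine ⟨by rwa [border_length], ?_⟩
    rw [border_getElem, if_neg (not_lt.2 h2.le)]

/-- The column and the row of an edge, for openers `O` and closers `C`. -/
def cell (O C : Finset ℕ) (e : ℕ × ℕ) : ℕ × ℕ :=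
  (countBelow O e.1, (C.filter (e.2 < ·)).card)

theorem rooks_eq (P : Matching m) :
    rooks P = (edges P).image (cell ((edges P).image Prod.fst) ((edges P).image Prod.snd)) := by
  rw [rooks, edges, Finset.image_image]
  change _ = Finset.image (fun v : Fin m => cell ((edges P).image Prod.fst)
    ((edges P).image Prod.snd) ((v : ℕ), (P.partner v : ℕ))) _
  congr 1
  funext v
  rw [cell, countBelow, ← Finset.card_map Fin.valEmbedding, ← Finset.card_map Fin.valEmbedding]
  congr 2
  · ext t
    simp only [Finset.mem_map, Finset.mem_filter, Finset.mem_univ, true_and,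
      Fin.valEmbedding_apply, mem_openers]
    constructor
    · rintro ⟨u, ⟨h1, h2⟩, rfl⟩
      exact ⟨⟨u.2, h1⟩, h2⟩
    · rintro ⟨⟨h1, h2⟩, h3⟩
      exact ⟨⟨t, h1⟩, ⟨h2, h3⟩, rfl⟩
  · ext t
    simp only [Finset.mem_map, Finset.mem_filter, Finset.mem_univ, true_and,
      Fin.valEmbedding_apply, mem_closers]
    constructor
    · rintro ⟨u, ⟨h1, h2⟩, rfl⟩
      exact ⟨⟨u.2, h1⟩, h2⟩
    · rintro ⟨⟨h1, h2⟩, h3⟩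
      exact ⟨⟨t, h1⟩, ⟨h2, h3⟩, rfl⟩

/-! ### Rooks in a rectangle as live edges -/

theorem countBelow_lt_iff {S : Finset ℕ} {s t : ℕ} (hs : s ∈ S) :
    countBelow S s < countBelow S t ↔ s < t := by
  constructor
  · intro h
    by_contra hc
    have := countBelow_mono S (not_lt.1 hc)
    omega
  · intro h
    have h1 := countBelow_succ S s
    have h2 := countBelow_mono S (show s + 1 ≤ t from h)
    rw [if_pos hs] at h1
    omega

theorem card_filter_lt_lt_iff {S : Finset ℕ} {s t : ℕ} (hs : s ∈ S) :
    (S.filter (s < ·)).card < (S.filter (t ≤ ·)).card ↔ t ≤ s := by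
  constructor
  · intro h
    by_contra hc
    have : (S.filter (t ≤ ·)).card ≤ (S.filter (s < ·)).card :=
      Finset.card_le_card fun x hx => by
        simp only [Finset.mem_filter] at hx ⊢
        exact ⟨hx.1, by omega⟩
    omega
  · intro h
    refine Finset.card_lt_card ⟨fun x hx => ?_, fun hsub => ?_⟩
    · simp only [Finset.mem_filter] at hx ⊢
      exact ⟨hx.1, by omega⟩
    · have := hsub (Finset.mem_filter.2 ⟨hs, h⟩)
      simp at this

theorem card_filter_lt_lt_iff' {S : Finset ℕ} {s t : ℕ} (hs : s ∈ S) :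
    (S.filter (s < ·)).card < (S.filter (t < ·)).card ↔ t < s := by
  have := card_filter_lt_lt_iff (t := t + 1) hs
  simpa [Nat.succ_le_iff] using this

/-- Meant for `cell`: rows are numbered from the last closer, so the order of closers is reversed
and increasing rooks are nested edges. -/
theorem longestIncreasing_image {S : Finset (ℕ × ℕ)} {φ : ℕ × ℕ → ℕ × ℕ}
    (hinj : Set.InjOn φ S) (h1 : ∀ e ∈ S, ∀ f ∈ S, ((φ e).1 < (φ f).1 ↔ e.1 < f.1))
    (h2 : ∀ e ∈ S, ∀ f ∈ S, ((φ e).2 < (φ f).2 ↔ f.2 < e.2)) :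
    longestIncreasing (S.image φ) = nestNum S := by
  classical
  apply le_antisymm
  · refine Finset.sup_le fun T hT => ?_
    rw [Finset.mem_filter, Finset.mem_powerset] at hT
    obtain ⟨T', hT', rfl⟩ := Finset.subset_image_iff.1 hT.1
    rw [Finset.card_image_of_injOn (hinj.mono hT')]
    refine card_le_nestNum hT' fun e he f hf hlt => ?_
    rw [← h2 e (hT' he) f (hT' hf)]
    exact hT.2 _ (Finset.mem_image_of_mem _ he) _ (Finset.mem_image_of_mem _ hf)
      ((h1 e (hT' he) f (hT' hf)).2 hlt)
  · obtain ⟨T, hT, hN, hc⟩ := exists_nested S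
    rw [← hc, ← Finset.card_image_of_injOn (hinj.mono hT)]
    refine Finset.le_sup (f := Finset.card) (Finset.mem_filter.2
      ⟨Finset.mem_powerset.2 (Finset.image_subset_image hT), ?_⟩)
    intro p hp q hq hpq
    obtain ⟨e, he, rfl⟩ := Finset.mem_image.1 hp
    obtain ⟨f, hf, rfl⟩ := Finset.mem_image.1 hq
    rw [h1 e (hT he) f (hT hf)] at hpq
    rw [h2 e (hT he) f (hT hf)]
    exact hN e he f hf hpq

/-- The rectangle below the `t`-th vertex has the columns of the openers before `t` and the rows of
the closers from `t` on, so its rooks are those of the live edges. -/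
theorem longestIncreasing_rooks {P : Matching m} (hP : ∀ v, P.partner v ≠ v) (t : ℕ) :
    longestIncreasing (rooks P ∩ rect (vertex (border P) t)) = nest (edges P) t := by
  classical
  have hE := isEdgeSet_edges P
  have hO : ∀ e ∈ edges P, e.1 ∈ (edges P).image Prod.fst := fun e he =>
    Finset.mem_image_of_mem _ he
  have hC : ∀ e ∈ edges P, e.2 ∈ (edges P).image Prod.snd := fun e he =>
    Finset.mem_image_of_mem _ he
  have hsub : ∀ e ∈ live (edges P) t, e ∈ edges P := fun e he => (mem_live.1 he).1
  have h0 : rooks P ∩ rect (vertex (border P) t) = (live (edges P) t).image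
      (cell ((edges P).image Prod.fst) ((edges P).image Prod.snd)) := by
    rw [rooks_eq, vertex_eq, positions_U_border, positions_D_border hP]
    ext c
    simp only [Finset.mem_inter, Finset.mem_image (s := edges P) (f := cell _ _),
      Finset.mem_image (s := live (edges P) t), rect, Finset.mem_product, Finset.mem_range]
    constructor
    · rintro ⟨⟨e, he, rfl⟩, h1, h2⟩
      exact ⟨e, mem_live.2 ⟨he, (countBelow_lt_iff (hO e he)).1 h1,
        (card_filter_lt_lt_iff (hC e he)).1 h2⟩, rfl⟩
    · rintro ⟨e, he, rfl⟩
      obtain ⟨h1, h2, h3⟩ := mem_live.1 he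
      exact ⟨⟨e, h1, rfl⟩, (countBelow_lt_iff (hO e h1)).2 h2,
        (card_filter_lt_lt_iff (hC e h1)).2 h3⟩
  have h1 : ∀ e ∈ live (edges P) t, ∀ f ∈ live (edges P) t,
      ((cell ((edges P).image Prod.fst) ((edges P).image Prod.snd) e).1 <
        (cell ((edges P).image Prod.fst) ((edges P).image Prod.snd) f).1 ↔ e.1 < f.1) :=
    fun e he f _ => countBelow_lt_iff (hO e (hsub e he))
  rw [h0, longestIncreasing_image (fun e he f hf h => ?_) h1
    (fun e he f _ => card_filter_lt_lt_iff' (hC e (hsub e he))), nest]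
  have a := h1 e he f hf
  have b := h1 f hf e he
  rw [h, lt_self_iff_false, false_iff] at a
  rw [h, lt_self_iff_false, false_iff] at b
  exact hE.fst_inj e (hsub e he) f (hsub f hf) (by omega)

end

/-! ### Patterns in a matching and in its edge set -/

/-- There are no edges `(i₁, i₅)`, `(i₂, i₆)`, `(i₃, i₄)` with `i₁ < ⋯ < i₆`. -/
def NoCrossingOverArc (E : Finset (ℕ × ℕ)) : Prop :=
  ∀ e ∈ E, ∀ f ∈ E, ∀ g ∈ E, e.1 < f.1 → f.1 < g.1 → g.2 < e.2 → ¬ e.2 < f.2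

section

variable {m : ℕ}

/-- An occurrence of a pattern uses matched vertices only, and the relabelling preserves their
order. -/
theorem removeFixed_avoids {l : ℕ} (M : Matching m) (τ : Equiv.Perm (Fin l)) :
    M.removeFixed.Avoids τ ↔ M.Avoids τ := by
  refine not_congr ⟨?_, ?_⟩
  · rintro ⟨i, hi, h⟩
    refine ⟨fun a => (M.matchedPts.orderIsoOfFin rfl (i a) : Fin m), fun a b hab => ?_,
      fun a => ?_⟩
    · exact (M.matchedPts.orderIsoOfFin rfl).strictMono (hi hab)
    · have := h a
      simp only [Matching.removeFixed, OrderIso.symm_apply_eq] at this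
      exact congrArg Subtype.val this
  · rintro ⟨i, hi, h⟩
    have hmem : ∀ a, i a ∈ M.matchedPts := by
      have hcl : ∀ a : Fin l, i (Fin.castLE (by omega) a) ∈ M.matchedPts := fun a => by
        simp only [Matching.matchedPts, Finset.mem_filter, Finset.mem_univ, true_and]
        rw [h a]
        intro he
        have := congrArg Fin.val (hi.injective he)
        simp only [Fin.val_rev, Fin.val_castLE] at this
        omega
      intro a
      by_cases ha : (a : ℕ) < l
      · exact hcl ⟨a, ha⟩
      -- A position `a` in the second half is the partner of the opener whose `τ`-value is the
      -- reverse of `a`.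
      · have := M.partner_mem_matchedPts ⟨_, hcl (τ.symm ⟨2 * l - 1 - a, by omega⟩)⟩
        simp only [h, Equiv.apply_symm_apply] at this
        convert this using 2
        ext
        simp only [Fin.val_rev, Fin.castLE_mk]
        omega
    refine ⟨fun a => (M.matchedPts.orderIsoOfFin rfl).symm ⟨i a, hmem a⟩, fun a b hab => ?_,
      fun a => ?_⟩
    · exact (M.matchedPts.orderIsoOfFin rfl).symm.strictMono (hi hab)
    · simp only [Matching.removeFixed, OrderIso.apply_symm_apply, h]

theorem avoids_321_iff (M : Matching m) :
    M.Avoids (Fin.revPerm : Equiv.Perm (Fin 3)) ↔ NoTripleCrossing (edges M) := by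
  constructor
  · intro h e he f hf g hg h1 h2 h3 h4 h5
    obtain ⟨a, a', rfl, -, ha, -⟩ := exists_of_mem_edges he
    obtain ⟨b, b', rfl, -, hb, -⟩ := exists_of_mem_edges hf
    obtain ⟨c, c', rfl, -, hc, -⟩ := exists_of_mem_edges hg
    refine h ⟨![a, b, c, a', b', c'], Fin.strictMono_iff_lt_succ.2 ?_, ?_⟩
    · intro i
      fin_cases i
      exacts [h1, h2, h3, h4, h5]
    · intro i
      fin_cases i
      exacts [ha, hb, hc]
  · rintro h ⟨i, hi, hp⟩
    have h0 := hp 0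
    have h1 := hp 1
    have h2 := hp 2
    change M.partner (i 0) = i 3 at h0
    change M.partner (i 1) = i 4 at h1
    change M.partner (i 2) = i 5 at h2
    exact h _ (mk_mem_edges.2 ⟨hi (by decide), h0⟩) _ (mk_mem_edges.2 ⟨hi (by decide), h1⟩) _
      (mk_mem_edges.2 ⟨hi (by decide), h2⟩) (hi (by decide : (0 : Fin 6) < 1))
      (hi (by decide : (1 : Fin 6) < 2)) (hi (by decide : (2 : Fin 6) < 3))
      (hi (by decide : (3 : Fin 6) < 4)) (hi (by decide : (4 : Fin 6) < 5))

theorem avoids_213_iff (M : Matching m) :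
    M.Avoids (Equiv.swap 0 1 : Equiv.Perm (Fin 3)) ↔ NoCrossingOverArc (edges M) := by
  constructor
  · intro h e he f hf g hg h1 h2 h3 h4
    obtain ⟨a, a', rfl, -, ha, -⟩ := exists_of_mem_edges he
    obtain ⟨b, b', rfl, -, hb, -⟩ := exists_of_mem_edges hf
    obtain ⟨c, c', rfl, h5, hc, -⟩ := exists_of_mem_edges hg
    refine h ⟨![a, b, c, c', a', b'], Fin.strictMono_iff_lt_succ.2 ?_, ?_⟩
    · intro i
      fin_cases i
      exacts [h1, h2, h5, h3, h4]
    · intro i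
      fin_cases i
      exacts [ha, hb, hc]
  · rintro h ⟨i, hi, hp⟩
    have h0 := hp 0
    have h1 := hp 1
    have h2 := hp 2
    change M.partner (i 0) = i 4 at h0
    change M.partner (i 1) = i 5 at h1
    change M.partner (i 2) = i 3 at h2
    exact h _ (mk_mem_edges.2 ⟨hi (by decide), h0⟩) _ (mk_mem_edges.2 ⟨hi (by decide), h1⟩) _
      (mk_mem_edges.2 ⟨hi (by decide), h2⟩) (hi (by decide : (0 : Fin 6) < 1))
      (hi (by decide : (1 : Fin 6) < 2)) (hi (by decide : (3 : Fin 6) < 4))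
      (hi (by decide : (4 : Fin 6) < 5))

/-! ### The matching `M.plus` -/

theorem plus_partner_castAdd_of_fixed (M : Matching m) {v : Fin m} (h : v ∈ M.fixedPts) :
    M.plus.partner (Fin.castAdd _ v) =
      Fin.natAdd m (Fin.rev ((M.fixedPts.orderIsoOfFin rfl).symm ⟨v, h⟩)) := by
  simp [Matching.plus, h]

theorem plus_partner_castAdd_of_not_fixed (M : Matching m) {v : Fin m} (h : v ∉ M.fixedPts) :
    M.plus.partner (Fin.castAdd _ v) = Fin.castAdd _ (M.partner v) := by
  simp [Matching.plus, h]

theorem plus_partner_natAdd (M : Matching m) (j : Fin M.fixedPts.card) :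
    M.plus.partner (Fin.natAdd m j) =
      Fin.castAdd _ (M.fixedPts.orderIsoOfFin rfl (Fin.rev j) : Fin m) := by
  simp [Matching.plus]

theorem plus_partner_ne (M : Matching m) (v : Fin (m + M.fixedPts.card)) :
    M.plus.partner v ≠ v := by
  induction v using Fin.addCases with
  | left v =>
    by_cases h : v ∈ M.fixedPts
    · rw [plus_partner_castAdd_of_fixed M h]
      intro he
      have := congrArg Fin.val he
      simp only [Fin.val_natAdd, Fin.val_castAdd] at this
      omega
    · rw [plus_partner_castAdd_of_not_fixed M h]
      rw [Matching.mem_fixedPts] at h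
      exact fun he => h (Fin.castAdd_injective _ _ he)
  | right j =>
    rw [plus_partner_natAdd]
    intro he
    have := congrArg Fin.val he
    simp only [Fin.val_natAdd, Fin.val_castAdd] at this
    omega

theorem mem_edges_plus (M : Matching m) (e : ℕ × ℕ) :
    e ∈ edges M.plus ↔ e ∈ edges M ∨ ∃ i : Fin M.fixedPts.card,
      e = (((M.fixedPts.orderIsoOfFin rfl i : Fin m) : ℕ), m + (Fin.rev i : ℕ)) := by
  constructor
  · intro he
    obtain ⟨u, v, rfl, h1, h2, -⟩ := exists_of_mem_edges he
    induction u using Fin.addCases with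
    | left u =>
      by_cases h : u ∈ M.fixedPts
      · right
        refine ⟨(M.fixedPts.orderIsoOfFin rfl).symm ⟨u, h⟩, ?_⟩
        rw [← h2, plus_partner_castAdd_of_fixed M h, OrderIso.apply_symm_apply]
        rfl
      · left
        rw [plus_partner_castAdd_of_not_fixed M h] at h2
        rw [← h2] at h1 ⊢
        exact mk_mem_edges.2 ⟨h1, rfl⟩
    | right j =>
      rw [plus_partner_natAdd] at h2
      rw [← h2, Fin.lt_def, Fin.val_natAdd, Fin.val_castAdd] at h1
      omega
  · rintro (he | ⟨i, rfl⟩)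
    · obtain ⟨u, v, rfl, h1, h2, -⟩ := exists_of_mem_edges he
      have h : u ∉ M.fixedPts := by
        rw [Matching.mem_fixedPts, h2]
        exact h1.ne'
      refine mk_mem_edges (P := M.plus) (u := Fin.castAdd _ u) (v := Fin.castAdd _ v) |>.2 ⟨h1, ?_⟩
      rw [plus_partner_castAdd_of_not_fixed M h, h2]
    · refine mk_mem_edges (P := M.plus)
        (u := Fin.castAdd _ (M.fixedPts.orderIsoOfFin rfl i : Fin m))
        (v := Fin.natAdd m (Fin.rev i)) |>.2 ⟨?_, ?_⟩
      · rw [Fin.lt_def, Fin.val_natAdd, Fin.val_castAdd]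
        omega
      · rw [plus_partner_castAdd_of_fixed M (M.fixedPts.orderIsoOfFin rfl i).2,
          Subtype.coe_eta, OrderIso.symm_apply_apply]

theorem lt_of_mem_edges {M : Matching m} {e : ℕ × ℕ} (h : e ∈ edges M) : e.1 < m ∧ e.2 < m := by
  obtain ⟨u, v, rfl, -⟩ := exists_of_mem_edges h
  exact ⟨u.2, v.2⟩

theorem mem_edges_iff_plus (M : Matching m) (e : ℕ × ℕ) :
    e ∈ edges M ↔ e ∈ edges M.plus ∧ e.2 < m := by
  rw [mem_edges_plus]
  constructor
  · exact fun h => ⟨Or.inl h, (lt_of_mem_edges h).2⟩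
  · rintro ⟨h | ⟨i, rfl⟩, h2⟩
    · exact h
    · simp only at h2
      omega

/-- The edges that end in one of the vertices from `m` on. -/
def tailEdges (E : Finset (ℕ × ℕ)) (m : ℕ) : Finset (ℕ × ℕ) := E.filter (fun e => m ≤ e.2)

theorem mem_tailEdges {E : Finset (ℕ × ℕ)} {e : ℕ × ℕ} :
    e ∈ tailEdges E m ↔ e ∈ E ∧ m ≤ e.2 := by
  simp [tailEdges]

theorem mem_tailEdges_plus (M : Matching m) (e : ℕ × ℕ) :
    e ∈ tailEdges (edges M.plus) m ↔ ∃ i : Fin M.fixedPts.card,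
      e = (((M.fixedPts.orderIsoOfFin rfl i : Fin m) : ℕ), m + (Fin.rev i : ℕ)) := by
  rw [mem_tailEdges, mem_edges_plus]
  constructor
  · rintro ⟨h | h, h2⟩
    · have := (lt_of_mem_edges h).2
      omega
    · exact h
  · rintro ⟨i, rfl⟩
    exact ⟨Or.inr ⟨i, rfl⟩, by simp⟩

theorem nested_tailEdges_plus (M : Matching m) : Nested (tailEdges (edges M.plus) m) := by
  intro e he f hf h
  obtain ⟨i, rfl⟩ := (mem_tailEdges_plus M e).1 he
  obtain ⟨j, rfl⟩ := (mem_tailEdges_plus M f).1 hf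
  have : i < j := (M.fixedPts.orderIsoOfFin rfl).lt_iff_lt.1 h
  simp only [Fin.val_rev]
  omega

theorem image_fst_tailEdges_plus (M : Matching m) :
    (tailEdges (edges M.plus) m).image Prod.fst = M.fixedPts.map Fin.valEmbedding := by
  ext t
  simp only [Finset.mem_image, Finset.mem_map, Fin.valEmbedding_apply]
  constructor
  · rintro ⟨e, he, rfl⟩
    obtain ⟨i, rfl⟩ := (mem_tailEdges_plus M e).1 he
    exact ⟨_, (M.fixedPts.orderIsoOfFin rfl i).2, rfl⟩
  · rintro ⟨v, hv, rfl⟩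
    refine ⟨_, (mem_tailEdges_plus M _).2 ⟨(M.fixedPts.orderIsoOfFin rfl).symm ⟨v, hv⟩, rfl⟩, ?_⟩
    simp only [OrderIso.apply_symm_apply]

theorem image_snd_tailEdges_plus (M : Matching m) :
    (tailEdges (edges M.plus) m).image Prod.snd = Finset.Ico m (m + M.fixedPts.card) := by
  ext t
  simp only [Finset.mem_image, Finset.mem_Ico]
  constructor
  · rintro ⟨e, he, rfl⟩
    obtain ⟨i, rfl⟩ := (mem_tailEdges_plus M e).1 he
    have := (Fin.rev i).2
    simp only
    omega
  · rintro ⟨h1, h2⟩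
    refine ⟨_, (mem_tailEdges_plus M _).2 ⟨Fin.rev ⟨t - m, by omega⟩, rfl⟩, ?_⟩
    simp only [Fin.rev_rev]
    omega

theorem mem_fixedPts_of_tail {M : Matching m} {e : ℕ × ℕ} (he : e ∈ edges M.plus)
    (h : m ≤ e.2) : ∃ h : e.1 < m, M.partner ⟨e.1, h⟩ = ⟨e.1, h⟩ := by
  have := Finset.mem_image_of_mem Prod.fst (mem_tailEdges.2 ⟨he, h⟩)
  rw [image_fst_tailEdges_plus] at this
  obtain ⟨v, hv, h⟩ := Finset.mem_map.1 this
  rw [Fin.valEmbedding_apply] at h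
  rw [Matching.mem_fixedPts] at hv
  have hlt : e.1 < m := h ▸ v.2
  have hv' : v = ⟨e.1, hlt⟩ := Fin.ext h
  exact ⟨hlt, hv' ▸ hv⟩

theorem exists_tail_of_fixed {M : Matching m} {v : Fin m} (h : M.partner v = v) :
    ∃ b, m ≤ b ∧ ((v : ℕ), b) ∈ edges M.plus := by
  have : (v : ℕ) ∈ (tailEdges (edges M.plus) m).image Prod.fst := by
    rw [image_fst_tailEdges_plus]
    exact Finset.mem_map_of_mem Fin.valEmbedding ((Matching.mem_fixedPts M v).2 h)
  obtain ⟨⟨a, b⟩, he, rfl⟩ := Finset.mem_image.1 this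
  exact ⟨b, (mem_tailEdges.1 he).2, (mem_tailEdges.1 he).1⟩

/-- Tail edges are nested, so in a triple crossing only the edge that closes last can end in the
tail. Its opener is then the forbidden fixed point `x₃`. -/
theorem noTripleCrossing_plus_iff (M : Matching m) :
    NoTripleCrossing (edges M.plus) ↔ NoTripleCrossing (edges M) ∧
      ∀ x₁ x₂ x₃ x₄ x₅, x₁ < x₂ → x₂ < x₃ → x₃ < x₄ → x₄ < x₅ →
        M.partner x₁ = x₄ → M.partner x₂ = x₅ → M.partner x₃ ≠ x₃ := by
  constructor
  · refine fun h => ⟨h.mono fun e he => ((mem_edges_iff_plus M e).1 he).1, ?_⟩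
    intro x₁ x₂ x₃ x₄ x₅ h1 h2 h3 h4 p1 p2 p3
    obtain ⟨b, hb, hm⟩ := exists_tail_of_fixed p3
    exact h _ ((mem_edges_iff_plus M _).1 (mk_mem_edges.2 ⟨by omega, p1⟩)).1 _
      ((mem_edges_iff_plus M _).1 (mk_mem_edges.2 ⟨by omega, p2⟩)).1 _ hm h1 h2 h3 h4
      (by have := x₅.2; simp only; omega)
  · rintro ⟨h, h'⟩ e he f hf g hg h1 h2 h3 h4 h5
    have hT := nested_tailEdges_plus M
    have hf2 : f.2 < m := by
      by_contra hc
      have := hT f (mem_tailEdges.2 ⟨hf, by omega⟩) g (mem_tailEdges.2 ⟨hg, by omega⟩) h2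
      omega
    have he' := (mem_edges_iff_plus M e).2 ⟨he, by omega⟩
    have hf' := (mem_edges_iff_plus M f).2 ⟨hf, hf2⟩
    by_cases hg2 : g.2 < m
    · exact h e he' f hf' g ((mem_edges_iff_plus M g).2 ⟨hg, hg2⟩) h1 h2 h3 h4 h5
    · obtain ⟨hlt, hfix⟩ := mem_fixedPts_of_tail hg (by omega)
      obtain ⟨a, a', rfl, -, ha, -⟩ := exists_of_mem_edges he'
      obtain ⟨b, b', rfl, -, hb, -⟩ := exists_of_mem_edges hf'
      exact h' a b ⟨g.1, hlt⟩ a' b' h1 h2 h3 h4 ha hb hfix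

/-- Again only the edge `f`, which closes last, can end in the tail; now its opener is the forbidden
fixed point `x₂`. -/
theorem noCrossingOverArc_plus_iff (M : Matching m) :
    NoCrossingOverArc (edges M.plus) ↔ NoCrossingOverArc (edges M) ∧
      ∀ x₁ x₂ x₃ x₄ x₅, x₁ < x₂ → x₂ < x₃ → x₃ < x₄ → x₄ < x₅ →
        M.partner x₁ = x₅ → M.partner x₃ = x₄ → M.partner x₂ ≠ x₂ := by
  constructor
  · refine fun h => ⟨fun e he f hf g hg => h e ((mem_edges_iff_plus M e).1 he).1
      f ((mem_edges_iff_plus M f).1 hf).1 g ((mem_edges_iff_plus M g).1 hg).1, ?_⟩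
    intro x₁ x₂ x₃ x₄ x₅ h1 h2 h3 h4 p1 p2 p3
    obtain ⟨b, hb, hm⟩ := exists_tail_of_fixed p3
    exact h _ ((mem_edges_iff_plus M _).1 (mk_mem_edges.2 ⟨by omega, p1⟩)).1 _ hm _
      ((mem_edges_iff_plus M _).1 (mk_mem_edges.2 ⟨by omega, p2⟩)).1 h1 h2 h4
      (by have := x₅.2; simp only; omega)
  · rintro ⟨h, h'⟩ e he f hf g hg h1 h2 h3 h4
    have hT := nested_tailEdges_plus M
    have he2 : e.2 < m := by
      by_contra hc
      have := hT e (mem_tailEdges.2 ⟨he, by omega⟩) f (mem_tailEdges.2 ⟨hf, by omega⟩) h1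
      omega
    have he' := (mem_edges_iff_plus M e).2 ⟨he, by omega⟩
    have hg' := (mem_edges_iff_plus M g).2 ⟨hg, by omega⟩
    by_cases hf2 : f.2 < m
    · exact h e he' f ((mem_edges_iff_plus M f).2 ⟨hf, hf2⟩) g hg' h1 h2 h3 h4
    · obtain ⟨hlt, hfix⟩ := mem_fixedPts_of_tail hf (by omega)
      obtain ⟨a, a', rfl, -, ha, -⟩ := exists_of_mem_edges he'
      obtain ⟨b, b', rfl, hlt', hb, -⟩ := exists_of_mem_edges hg'
      exact h' a ⟨f.1, hlt⟩ b b' a' h1 h2 hlt' h3 ha hb hfix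

/-! ### Reduction to perfect matchings -/

theorem mem_matchings321 {n k : ℕ} {M : Matching (2 * n + k)} :
    M ∈ matchings321 n k ↔ M.fixedPts.card = k ∧ NoTripleCrossing (edges M.plus) := by
  rw [noTripleCrossing_plus_iff, ← avoids_321_iff, ← removeFixed_avoids]
  rfl

theorem mem_matchings213 {n k : ℕ} {M : Matching (2 * n + k)} :
    M ∈ matchings213 n k ↔ M.fixedPts.card = k ∧ NoCrossingOverArc (edges M.plus) := by
  rw [noCrossingOverArc_plus_iff, ← avoids_213_iff, ← removeFixed_avoids]
  rfl

theorem plus_injective {M M' : Matching m} (h : edges M.plus = edges M'.plus) : M = M' := by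
  apply edges_injective
  ext e
  rw [mem_edges_iff_plus M, mem_edges_iff_plus M', h]

theorem Nested.noncrossing_of_fst_lt {S : Finset (ℕ × ℕ)} (h : Nested S) : Noncrossing S :=
  fun e he f hf h1 _ h3 => by have := h e he f hf h1; omega

/-- Every perfect matching on `m + k` vertices whose last `k` vertices are closers of nested edges
comes from a matching with `k` fixed points. -/
theorem exists_plus {k : ℕ} {E : Finset (ℕ × ℕ)} (hE : IsEdgeSet E)
    (hcov : ∀ t < m + k, t ∈ E.image Prod.fst ∨ t ∈ E.image Prod.snd)
    (hlt : ∀ e ∈ E, e.2 < m + k) (htail : ∀ t, m ≤ t → t < m + k → t ∈ E.image Prod.snd)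
    (hN : Nested (tailEdges E m)) :
    ∃ M : Matching m, M.fixedPts.card = k ∧ edges M.plus = E := by
  classical
  obtain ⟨M, hM⟩ := exists_matching (m := m) (E := E.filter (fun e => e.2 < m))
    (hE.mono (Finset.filter_subset _ _)) (fun e he => (Finset.mem_filter.1 he).2)
  have hfst : ∀ e ∈ E, e.1 < m := fun e he => by
    by_contra hc
    have h1 := hE.lt e he
    obtain ⟨f, hf, h⟩ := Finset.mem_image.1 (htail e.1 (by omega)
      (by have := hlt e he; omega))
    exact hE.fst_ne_snd e he f hf h.symm
  -- `M` consists of the edges that close before `m`. As `E` covers every vertex, the vertices that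
  -- `M` leaves unmatched are the openers of the tail edges.
  have hO : (tailEdges E m).image Prod.fst = M.fixedPts.map Fin.valEmbedding := by
    ext t
    simp only [Finset.mem_image, Finset.mem_map, Fin.valEmbedding_apply, Matching.mem_fixedPts]
    constructor
    · rintro ⟨e, he, rfl⟩
      rw [mem_tailEdges] at he
      refine ⟨⟨e.1, hfst e he.1⟩, ?_, rfl⟩
      rcases lt_trichotomy (M.partner ⟨e.1, hfst e he.1⟩) ⟨e.1, hfst e he.1⟩ with h | h | h
      · have := (mk_mem_edges (P := M)).2 ⟨h, M.involutive _⟩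
        rw [hM] at this
        exact absurd rfl (hE.fst_ne_snd e he.1 _ (Finset.mem_filter.1 this).1)
      · exact h
      · have := (mk_mem_edges (P := M)).2 ⟨h, rfl⟩
        rw [hM, Finset.mem_filter] at this
        have h2 := hE.fst_inj e he.1 _ this.1 rfl
        have h3 := this.2
        rw [← h2] at h3
        omega
    · rintro ⟨v, hv, rfl⟩
      have hnot : ∀ e ∈ edges M, e.1 ≠ v ∧ e.2 ≠ v := fun e he => by
        obtain ⟨a, b, rfl, hab, h1, h2⟩ := exists_of_mem_edges he
        constructor
        · intro h
          obtain rfl : a = v := Fin.ext h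
          rw [← h1, hv] at hab
          exact lt_irrefl _ hab
        · intro h
          obtain rfl : b = v := Fin.ext h
          rw [← h2, hv] at hab
          exact lt_irrefl _ hab
      rcases hcov v (by have := v.2; omega) with h | h
      · obtain ⟨e, he, h⟩ := Finset.mem_image.1 h
        refine ⟨e, mem_tailEdges.2 ⟨he, ?_⟩, h⟩
        by_contra hc
        exact (hnot e (hM ▸ Finset.mem_filter.2 ⟨he, by omega⟩)).1 h
      · obtain ⟨e, he, h⟩ := Finset.mem_image.1 h
        exact absurd h (hnot e (hM ▸ Finset.mem_filter.2 ⟨he, by have := v.2; omega⟩)).2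
  have hC : (tailEdges E m).image Prod.snd = Finset.Ico m (m + k) := by
    ext t
    rw [Finset.mem_image, Finset.mem_Ico]
    constructor
    · rintro ⟨e, he, rfl⟩
      rw [mem_tailEdges] at he
      exact ⟨he.2, hlt e he.1⟩
    · rintro ⟨h1, h2⟩
      obtain ⟨e, he, rfl⟩ := Finset.mem_image.1 (htail t h1 h2)
      exact ⟨e, mem_tailEdges.2 ⟨he, h1⟩, rfl⟩
  have hT : IsEdgeSet (tailEdges E m) := hE.mono (Finset.filter_subset _ _)
  have hcard : M.fixedPts.card = k := by
    rw [← Finset.card_map Fin.valEmbedding, ← hO,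
      Finset.card_image_of_injOn fun e he f hf h => hT.fst_inj e he f hf h,
      ← Finset.card_image_of_injOn (f := Prod.snd) fun e he f hf h => hT.snd_inj e he f hf h, hC,
      Nat.card_Ico]
    omega
  -- Nested families are noncrossing, so they agree once their openers and closers do.
  have htails : tailEdges (edges M.plus) m = tailEdges E m :=
    noncrossing_unique ((isEdgeSet_edges _).mono (Finset.filter_subset _ _)) hT
      (nested_tailEdges_plus M).noncrossing_of_fst_lt hN.noncrossing_of_fst_lt
      (by rw [hO, image_fst_tailEdges_plus]) (by rw [hC, image_snd_tailEdges_plus, hcard])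
  refine ⟨M, hcard, ?_⟩
  ext e
  by_cases he : e.2 < m
  · have := mem_edges_iff_plus M e
    rw [hM, Finset.mem_filter] at this
    tauto
  · have := Finset.ext_iff.1 htails e
    rw [mem_tailEdges, mem_tailEdges] at this
    have h2 : m ≤ e.2 := by omega
    tauto

end

/-! ### Perfect matchings and Dyck words -/

theorem exists_equiv_of_rel {α β : Type*} {A : Set α} {B : Set β} {R : α → β → Prop}
    (h1 : ∀ a ∈ A, ∃ b ∈ B, R a b) (h2 : ∀ b ∈ B, ∃ a ∈ A, R a b)
    (h3 : ∀ a ∈ A, ∀ a' ∈ A, ∀ b ∈ B, R a b → R a' b → a = a')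
    (h4 : ∀ a ∈ A, ∀ b ∈ B, ∀ b' ∈ B, R a b → R a b' → b = b') :
    ∃ Φ : A ≃ B, ∀ a : A, R a.1 (Φ a).1 := by
  choose f hf hR using h1
  refine ⟨Equiv.ofBijective (fun a : A => (⟨f a.1 a.2, hf a.1 a.2⟩ : B)) ⟨?_, ?_⟩,
    fun a => hR a.1 a.2⟩
  · rintro ⟨a, ha⟩ ⟨a', ha'⟩ h
    have h : f a ha = f a' ha' := congrArg Subtype.val h
    exact Subtype.ext (h3 a ha a' ha' _ (hf a ha) (hR a ha) (h ▸ hR a' ha'))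
  · rintro ⟨b, hb⟩
    obtain ⟨a, ha, hab⟩ := h2 b hb
    exact ⟨⟨a, ha⟩, Subtype.ext (h4 a ha _ (hf a ha) b hb (hR a ha) hab)⟩

theorem ext_positions {w w' : List DyckStep} (hl : w.length = w'.length)
    (h : positions DyckStep.U w = positions DyckStep.U w') : w = w' := by
  refine List.ext_getElem hl fun t h1 h2 => ?_
  have := Finset.ext_iff.1 h t
  simp only [mem_positions, List.getElem?_eq_getElem h1, List.getElem?_eq_getElem h2,
    Option.some.injEq] at this
  rcases w[t].dichotomy with h3 | h3 <;> rcases w'[t].dichotomy with h4 | h4 <;> simp_all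

section

variable {m : ℕ}

theorem height_border {P : Matching m} (hP : ∀ v, P.partner v ≠ v) (t : ℕ) :
    height (border P) t = (live (edges P) t).card := by
  rw [height_eq, positions_U_border, positions_D_border hP, (isEdgeSet_edges P).card_live t]
  push_cast
  ring

theorem height_eq_card_live {w : DyckWord} {E : Finset (ℕ × ℕ)} (hE : IsEdgeSet E)
    (hO : E.image Prod.fst = positions DyckStep.U w.toList)
    (hC : E.image Prod.snd = positions DyckStep.D w.toList) (t : ℕ) :
    height w.toList t = (live E t).card := by
  have := hE.card_live t
  rw [hO, hC] at this
  rw [height_eq, this]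
  push_cast
  ring

theorem live_of_length_le (P : Matching m) {t : ℕ} (h : m ≤ t) : live (edges P) t = ∅ := by
  ext e
  simp only [mem_live, Finset.notMem_empty, iff_false, not_and]
  intro he _
  have := (lt_of_mem_edges he).2
  omega

theorem exists_dyckWord_border {P : Matching m} (hP : ∀ v, P.partner v ≠ v) :
    ∃ w : DyckWord, w.toList = border P := by
  have h := height_border hP
  have h1 := h m
  rw [live_of_length_le P le_rfl, height, List.take_of_length_le (border_length P).le,
    Finset.card_empty] at h1
  refine ⟨⟨border P, by omega, fun i => ?_⟩, rfl⟩
  have := h i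
  unfold height at this
  omega

theorem live_plus_eq_tail (M : Matching m) :
    live (edges M.plus) m = tailEdges (edges M.plus) m := by
  ext e
  rw [mem_live, mem_tailEdges]
  constructor
  · exact fun h => ⟨h.1, h.2.2⟩
  · exact fun h => ⟨h.1, (mem_fixedPts_of_tail h.1 h.2).1, h.2⟩

theorem card_tailEdges_plus (M : Matching m) :
    (tailEdges (edges M.plus) m).card = M.fixedPts.card := by
  have h := congrArg Finset.card (image_fst_tailEdges_plus M)
  rwa [Finset.card_map, Finset.card_image_of_injOn fun e he f hf h =>
    (isEdgeSet_edges M.plus).fst_inj e (mem_tailEdges.1 he).1 f (mem_tailEdges.1 hf).1 h] at h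

theorem mem_positions_of_suffix {k : ℕ} {w : List DyckStep}
    (h : List.replicate k DyckStep.D <:+ w) {t : ℕ} (h1 : w.length ≤ t + k) (h2 : t < w.length) :
    t ∈ positions DyckStep.D w := by
  obtain ⟨l, rfl⟩ := h
  rw [List.length_append, List.length_replicate] at h1 h2
  rw [mem_positions, List.getElem?_append_right (by omega),
    List.getElem?_replicate_of_lt (by omega)]

/-- A perfect matching on the steps of a Dyck word that ends with `k` south steps comes from a
matching with `k` fixed points, if the last `k` closers belong to nested edges. -/
theorem exists_plus_of_dyckWord {n k : ℕ} {w : DyckWord} (hw : w.semilength = n + k)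
    (hk : List.replicate k DyckStep.D <:+ w.toList) {E : Finset (ℕ × ℕ)} (hE : IsEdgeSet E)
    (hO : E.image Prod.fst = positions DyckStep.U w.toList)
    (hC : E.image Prod.snd = positions DyckStep.D w.toList)
    (hN : Nested (live E (2 * n + k))) :
    ∃ M : Matching (2 * n + k), M.fixedPts.card = k ∧ edges M.plus = E ∧
      w.toList = border M.plus := by
  have hlen := length_eq w
  have htail : ∀ t, 2 * n + k ≤ t → t < 2 * n + k + k → t ∈ E.image Prod.snd := fun t h1 h2 => by
    rw [hC]
    exact mem_positions_of_suffix hk (by omega) (by omega)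
  have hlt : ∀ e ∈ E, e.2 < 2 * n + k + k := fun e he => by
    have h1 := Finset.mem_image_of_mem Prod.snd he
    rw [hC] at h1
    have := lt_length_of_mem_positions h1
    omega
  have hTl : tailEdges E (2 * n + k) ⊆ live E (2 * n + k) := fun e he => by
    rw [mem_tailEdges] at he
    refine mem_live.2 ⟨he.1, ?_, he.2⟩
    by_contra hc
    have h1 := htail e.1 (by omega) ((hE.lt e he.1).trans (hlt e he.1))
    obtain ⟨f, hf, h⟩ := Finset.mem_image.1 h1
    exact hE.fst_ne_snd e he.1 f hf h.symm
  obtain ⟨M, hM, hME⟩ := exists_plus hE (fun t ht => by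
    rw [hO, hC]
    exact mem_positions_or (by omega)) hlt htail (hN.mono hTl)
  refine ⟨M, hM, hME, ext_positions ?_ ?_⟩
  · rw [border_length, hM]
    omega
  · rw [positions_U_border, hME, hO]

theorem semilength_of_border {n k : ℕ} {M : Matching (2 * n + k)} (hM : M.fixedPts.card = k)
    {w : DyckWord} (hw : w.toList = border M.plus) : w.semilength = n + k := by
  have := length_eq w
  rw [hw, border_length] at this
  omega

theorem suffix_of_border {n k : ℕ} {M : Matching (2 * n + k)} (hM : M.fixedPts.card = k)
    {w : DyckWord} (hw : w.toList = border M.plus) :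
    List.replicate k DyckStep.D <:+ w.toList := by
  rw [suffix_iff_height (semilength_of_border hM hw), hw, height_border (plus_partner_ne M),
    live_plus_eq_tail, card_tailEdges_plus, hM]

theorem image_snd_of_border {M : Matching m} {w : DyckWord} (hw : w.toList = border M.plus) :
    (edges M.plus).image Prod.snd = positions DyckStep.D w.toList := by
  rw [hw, positions_D_border (plus_partner_ne M)]

theorem image_fst_of_border {M : Matching m} {w : DyckWord} (hw : w.toList = border M.plus) :
    (edges M.plus).image Prod.fst = positions DyckStep.U w.toList := by
  rw [hw, positions_U_border]

end

/-! ### The bijection for `321`-avoiding matchings -/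

theorem isDelta321_plus_iff {m : ℕ} (M : Matching m) (p : DyckWord × DyckWord) :
    IsDelta321 M.plus p ↔ p.2.toList = border M.plus ∧ ∀ t ≤ m + M.fixedPts.card,
      height p.1.toList t = 2 * (nest (edges M.plus) t : ℤ) - (live (edges M.plus) t).card := by
  unfold IsDelta321
  simp only [longestIncreasing_rooks (plus_partner_ne M), height_border (plus_partner_ne M)]

theorem height_step {w : List DyckStep} {t : ℕ} (h : t < w.length) :
    height w (t + 1) = height w t + 1 ∨ height w (t + 1) = height w t - 1 := by
  rw [height_succ h]
  split_ifs
  · exact Or.inl rfl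
  · exact Or.inr (by ring)

theorem exists_noncrossingPair_321 {n k : ℕ} {M : Matching (2 * n + k)}
    (hM : M ∈ matchings321 n k) : ∃ p ∈ noncrossingPairs n k, IsDelta321 M.plus p := by
  obtain ⟨hk, h3⟩ := mem_matchings321.1 hM
  obtain ⟨w, hw⟩ := exists_dyckWord_border (plus_partner_ne M)
  have hs := semilength_of_border hk hw
  have hlen := length_eq w
  have hE := isEdgeSet_edges M.plus
  have hh := height_eq_card_live hE (image_fst_of_border hw) (image_snd_of_border hw)
  have hp := hE.isProfile h3
  have hle : ∀ t, nest (edges M.plus) t ≤ (live (edges M.plus) t).card := fun t =>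
    nestNum_le_card _
  have hge : ∀ t, (live (edges M.plus) t).card ≤ 2 * nest (edges M.plus) t := fun t => by
    have := hp.height_le t
    have := hE.card_live t
    omega
  have hend : (live (edges M.plus) (2 * (n + k))).card = 0 := by
    rw [live_of_length_le M.plus (by omega), Finset.card_empty]
  obtain ⟨v, hv, hvh⟩ := exists_dyckWord (N := n + k)
    (b := fun t => 2 * (nest (edges M.plus) t : ℤ) - (live (edges M.plus) t).card)
    (by simp [hp.zero, live_zero])
    -- Here `h` changes by one, and `ℓ` either stays or changes by one in the same direction, so `2ℓ
    -- - h` changes by `±1`.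
    (fun t ht => by
      have h1 := hE.card_live t
      have h2 := hE.card_live (t + 1)
      rw [countBelow_succ, countBelow_succ] at h2
      rcases mem_positions_or (w := w.toList) (t := t) (by omega) with h | h
      · have h' := positions_disjoint h
        rw [← image_fst_of_border hw] at h
        rw [← image_snd_of_border hw] at h'
        rw [if_pos h, if_neg h'] at h2
        have := hp.opener t h
        omega
      · have h' : t ∉ positions DyckStep.U w.toList := fun hU => positions_disjoint hU h
        rw [← image_snd_of_border hw] at h
        rw [← image_fst_of_border hw] at h'
        rw [if_pos h, if_neg h'] at h2
        have := hp.closer t h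
        omega)
    (fun t _ => by have := hge t; omega)
    (by have := hle (2 * (n + k)); omega)
  refine ⟨(v, w), ⟨hv, hs, fun t => ?_, ?_, suffix_of_border hk hw⟩, ?_⟩
  · dsimp only
    by_cases ht : t ≤ 2 * (n + k)
    · rw [hvh t ht, hh]
      have := hle t
      omega
    · rw [height_eq_of_semilength hv (by omega), height_eq_of_semilength hs (by omega)]
  · rw [suffix_iff_height hv, hvh _ (by omega)]
    -- The edges over this gap are the nested tail edges, so `ℓ = h = k` and both paths have height
    -- `k` here.
    have h1 : nest (edges M.plus) (2 * n + k) = (live (edges M.plus) (2 * n + k)).card :=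
      Nested.nestNum_eq (by rw [live_plus_eq_tail]; exact nested_tailEdges_plus M)
    rw [h1, live_plus_eq_tail, card_tailEdges_plus, hk]
    ring
  · rw [isDelta321_plus_iff]
    exact ⟨hw, fun t ht => hvh t (by omega)⟩

/-- At each step both heights change by `±1`, so their sum stays even. Half of it is the nesting
number that the matching has to realize. -/
theorem exists_two_mul_eq {v w : DyckWord} {N : ℕ} (hv : v.semilength = N)
    (hw : w.semilength = N) (t : ℕ) :
    ∃ ℓ : ℕ, 2 * (ℓ : ℤ) = height v.toList t + height w.toList t := by
  have hpar : ∀ t, ∃ z : ℤ, 2 * z = height v.toList t + height w.toList t := by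
    intro t
    induction t with
    | zero => exact ⟨0, by simp [height_zero]⟩
    | succ t ih =>
      obtain ⟨z, hz⟩ := ih
      by_cases ht : t < 2 * N
      · have h1 := height_step (w := v.toList) (t := t) (by rw [length_eq]; omega)
        have h2 := height_step (w := w.toList) (t := t) (by rw [length_eq]; omega)
        rcases h1 with h1 | h1 <;> rcases h2 with h2 | h2
        exacts [⟨z + 1, by omega⟩, ⟨z, by omega⟩, ⟨z, by omega⟩, ⟨z - 1, by omega⟩]
      · rw [height_eq_of_semilength hv (by omega), height_eq_of_semilength hw (by omega)]
        exact ⟨0, by norm_num⟩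
  obtain ⟨z, hz⟩ := hpar t
  have h1 := height_nonneg v t
  have h2 := height_nonneg w t
  exact ⟨z.toNat, by omega⟩

theorem exists_matching_321 {n k : ℕ} {p : DyckWord × DyckWord}
    (hp : p ∈ noncrossingPairs n k) : ∃ M ∈ matchings321 n k, IsDelta321 M.plus p := by
  obtain ⟨v, w⟩ := p
  obtain ⟨hv, hw, hle, hkv, hkw⟩ := hp
  dsimp only at hv hw hle hkv hkw
  have hlv := length_eq v
  have hlw := length_eq w
  choose ℓ hℓ using exists_two_mul_eq hv hw
  have hhw := height_eq w.toList
  have hprof : IsProfile (positions DyckStep.U w.toList) (positions DyckStep.D w.toList) ℓ := by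
    refine ⟨fun t => positions_disjoint, by rw [card_positions, card_positions], ?_, ?_, ?_, ?_,
      ?_, ?_⟩
    · have := hℓ 0
      rw [height_zero, height_zero] at this
      omega
    · intro t ht
      have h1 := height_step (w := v.toList) (t := t)
        (by have := lt_length_of_mem_positions ht; omega)
      have h2 := hhw (t + 1)
      rw [countBelow_succ, countBelow_succ, if_pos ht, if_neg (positions_disjoint ht)] at h2
      have := hhw t
      have := hℓ t
      have := hℓ (t + 1)
      omega
    · intro t ht
      have h1 := height_step (w := v.toList) (t := t)
        (by have := lt_length_of_mem_positions ht; omega)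
      have h2 := hhw (t + 1)
      rw [countBelow_succ, countBelow_succ, if_pos ht,
        if_neg (fun h => positions_disjoint h ht)] at h2
      have := hhw t
      have := hℓ t
      have := hℓ (t + 1)
      omega
    · intro t h1 h2
      have ht : ¬ t < w.toList.length := fun h => by
        rcases mem_positions_or h with h | h
        exacts [h1 h, h2 h]
      have h3 := hℓ t
      have h4 := hℓ (t + 1)
      rw [height_eq_of_semilength hv (by omega), height_eq_of_semilength hw (by omega)] at h3 h4
      omega
    · intro t
      have := hℓ t
      have := hle t
      have := hhw t
      omega
    · intro t
      have := hℓ t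
      have := height_nonneg v t
      have := hhw t
      omega
  obtain ⟨E, hE, h3, hO, hC, hn⟩ := exists_edgeSet hprof
  have hh := height_eq_card_live hE hO hC
  rw [suffix_iff_height hv] at hkv
  have hkw' := hkw
  rw [suffix_iff_height hw] at hkw'
  -- Both paths have height `k` at this point, so the nesting number equals the number of live
  -- edges.
  have hN : Nested (live E (2 * n + k)) := by
    refine nested_of_nestNum_eq ?_
    have h1 := hℓ (2 * n + k)
    have h2 := hh (2 * n + k)
    have h4 := hn (2 * n + k)
    unfold nest at h4
    omega
  obtain ⟨M, hM, rfl, hb⟩ := exists_plus_of_dyckWord hw hkw hE hO hC hN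
  refine ⟨M, mem_matchings321.2 ⟨hM, h3⟩, ?_⟩
  rw [isDelta321_plus_iff]
  refine ⟨hb, fun t _ => ?_⟩
  have := hℓ t
  rw [hn, ← hh]
  dsimp only
  omega

theorem isDelta321_left_unique {n k : ℕ} {M M' : Matching (2 * n + k)}
    (hM : M ∈ matchings321 n k) (hM' : M' ∈ matchings321 n k) {p : DyckWord × DyckWord}
    (h : IsDelta321 M.plus p) (h' : IsDelta321 M'.plus p) : M = M' := by
  obtain ⟨hk, h3⟩ := mem_matchings321.1 hM
  obtain ⟨hk', h3'⟩ := mem_matchings321.1 hM'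
  rw [isDelta321_plus_iff] at h h'
  refine plus_injective (edgeSet_unique (isEdgeSet_edges _) (isEdgeSet_edges _) h3 h3'
    (by rw [image_fst_of_border h.1, image_fst_of_border h'.1])
    (by rw [image_snd_of_border h.1, image_snd_of_border h'.1]) fun t => ?_)
  by_cases ht : t ≤ 2 * n + k + k
  · have h1 := h.2 t (by omega)
    have h2 := h'.2 t (by omega)
    rw [← height_border (plus_partner_ne M), ← h.1] at h1
    rw [← height_border (plus_partner_ne M'), ← h'.1] at h2
    omega
  · rw [nest, nest, live_of_length_le M.plus (by omega), live_of_length_le M'.plus (by omega)]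

theorem isDelta321_right_unique {n k : ℕ} {M : Matching (2 * n + k)}
    (hM : M ∈ matchings321 n k) {p p' : DyckWord × DyckWord} (hp : p ∈ noncrossingPairs n k)
    (hp' : p' ∈ noncrossingPairs n k) (h : IsDelta321 M.plus p) (h' : IsDelta321 M.plus p') :
    p = p' := by
  obtain ⟨hk, -⟩ := mem_matchings321.1 hM
  refine Prod.ext (dyckWord_ext (hp.1.trans hp'.1.symm) fun t ht => ?_)
    (DyckWord.ext (h.1.trans h'.1.symm))
  have := hp.1
  rw [h.2 t (by omega), h'.2 t (by omega)]

theorem exists_equiv_321 (n k : ℕ) : ∃ Φ : matchings321 n k ≃ noncrossingPairs n k,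
    ∀ M : matchings321 n k, IsDelta321 M.1.plus (Φ M).1 :=
  exists_equiv_of_rel (R := fun M p => IsDelta321 M.plus p)
    (fun _ hM => exists_noncrossingPair_321 hM) (fun _ hp => exists_matching_321 hp)
    (fun _ hM _ hM' _ _ h h' => isDelta321_left_unique hM hM' h h')
    (fun _ hM _ hp _ hp' h h' => isDelta321_right_unique hM hp hp' h h')

/-! ### Full rook placements -/

/-- `R` has exactly one rook in each of the first `N` rows and columns. -/
structure IsFull (N : ℕ) (R : Finset (ℕ × ℕ)) : Prop where
  fst_inj : ∀ r ∈ R, ∀ s ∈ R, r.1 = s.1 → r = s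
  snd_inj : ∀ r ∈ R, ∀ s ∈ R, r.2 = s.2 → r = s
  image_fst : R.image Prod.fst = Finset.range N
  image_snd : R.image Prod.snd = Finset.range N

/-- The set of rooks of an edge set. -/
def cells (E : Finset (ℕ × ℕ)) : Finset (ℕ × ℕ) :=
  E.image (cell (E.image Prod.fst) (E.image Prod.snd))

theorem countBelow_injOn {S : Finset ℕ} {s t : ℕ} (hs : s ∈ S) (ht : t ∈ S)
    (h : countBelow S s = countBelow S t) : s = t := by
  have h1 := countBelow_lt_iff (t := t) hs
  have h2 := countBelow_lt_iff (t := s) ht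
  omega

theorem card_filter_lt_injOn {S : Finset ℕ} {s t : ℕ} (hs : s ∈ S) (ht : t ∈ S)
    (h : (S.filter (s < ·)).card = (S.filter (t < ·)).card) : s = t := by
  have h1 := card_filter_lt_lt_iff' (t := t) hs
  have h2 := card_filter_lt_lt_iff' (t := s) ht
  omega

theorem image_countBelow (S : Finset ℕ) : S.image (countBelow S) = Finset.range S.card := by
  refine Finset.eq_of_subset_of_card_le (fun x hx => ?_) ?_
  · obtain ⟨s, hs, rfl⟩ := Finset.mem_image.1 hx
    exact Finset.mem_range.2 (Finset.card_lt_card (Finset.filter_ssubset.2 ⟨s, hs, lt_irrefl _⟩))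
  · rw [Finset.card_range,
      Finset.card_image_of_injOn fun s hs t ht h => countBelow_injOn hs ht h]

theorem image_card_filter_lt (S : Finset ℕ) :
    S.image (fun s => (S.filter (s < ·)).card) = Finset.range S.card := by
  refine Finset.eq_of_subset_of_card_le (fun x hx => ?_) ?_
  · obtain ⟨s, hs, rfl⟩ := Finset.mem_image.1 hx
    exact Finset.mem_range.2 (Finset.card_lt_card (Finset.filter_ssubset.2 ⟨s, hs, lt_irrefl _⟩))
  · rw [Finset.card_range,
      Finset.card_image_of_injOn fun s hs t ht h => card_filter_lt_injOn hs ht h]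

theorem cell_injOn {O C : Finset ℕ} {e f : ℕ × ℕ} (he : e.1 ∈ O ∧ e.2 ∈ C)
    (hf : f.1 ∈ O ∧ f.2 ∈ C) (h : cell O C e = cell O C f) : e = f := by
  obtain ⟨h1, h2⟩ := Prod.ext_iff.1 h
  exact Prod.ext (countBelow_injOn he.1 hf.1 h1) (card_filter_lt_injOn he.2 hf.2 h2)

/-- The rooks alone fix the order among openers, whatever the border path. The order between an
opener and a closer does depend on the path. -/
theorem fst_lt_of_cell_eq {O C O' C' : Finset ℕ} {e f e' f' : ℕ × ℕ} (he : e.1 ∈ O)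
    (he' : e'.1 ∈ O') (h1 : cell O C e = cell O' C' e')
    (h2 : cell O C f = cell O' C' f') : e.1 < f.1 ↔ e'.1 < f'.1 := by
  rw [← countBelow_lt_iff he, ← countBelow_lt_iff he']
  have h1 := (Prod.ext_iff.1 h1).1
  have h2 := (Prod.ext_iff.1 h2).1
  simp only [cell] at h1 h2
  rw [h1, h2]

theorem snd_lt_of_cell_eq {O C O' C' : Finset ℕ} {e f e' f' : ℕ × ℕ} (hf : f.2 ∈ C)
    (hf' : f'.2 ∈ C') (h1 : cell O C e = cell O' C' e')
    (h2 : cell O C f = cell O' C' f') : e.2 < f.2 ↔ e'.2 < f'.2 := by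
  rw [← card_filter_lt_lt_iff' hf, ← card_filter_lt_lt_iff' hf']
  have h1 := (Prod.ext_iff.1 h1).2
  have h2 := (Prod.ext_iff.1 h2).2
  simp only [cell] at h1 h2
  rw [h1, h2]

section

variable {E : Finset (ℕ × ℕ)}

theorem mem_images {e : ℕ × ℕ} (he : e ∈ E) :
    e.1 ∈ E.image Prod.fst ∧ e.2 ∈ E.image Prod.snd :=
  ⟨Finset.mem_image_of_mem _ he, Finset.mem_image_of_mem _ he⟩

theorem IsEdgeSet.isFull_cells (hE : IsEdgeSet E) : IsFull E.card (cells E) := by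
  have hO : (E.image Prod.fst).card = E.card :=
    Finset.card_image_of_injOn fun e he f hf h => hE.fst_inj e he f hf h
  have hC : (E.image Prod.snd).card = E.card :=
    Finset.card_image_of_injOn fun e he f hf h => hE.snd_inj e he f hf h
  refine ⟨?_, ?_, ?_, ?_⟩
  · intro r hr s hs h
    obtain ⟨e, he, rfl⟩ := Finset.mem_image.1 hr
    obtain ⟨f, hf, rfl⟩ := Finset.mem_image.1 hs
    rw [hE.fst_inj e he f hf (countBelow_injOn (mem_images he).1 (mem_images hf).1 h)]
  · intro r hr s hs h
    obtain ⟨e, he, rfl⟩ := Finset.mem_image.1 hr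
    obtain ⟨f, hf, rfl⟩ := Finset.mem_image.1 hs
    rw [hE.snd_inj e he f hf (card_filter_lt_injOn (mem_images he).2 (mem_images hf).2 h)]
  · rw [cells, Finset.image_image, ← hO, ← image_countBelow, Finset.image_image]
    rfl
  · rw [cells, Finset.image_image, ← hC, ← image_card_filter_lt, Finset.image_image]
    rfl

theorem eq_of_cells_eq {F : Finset (ℕ × ℕ)} (hO : E.image Prod.fst = F.image Prod.fst)
    (hC : E.image Prod.snd = F.image Prod.snd) (h : cells E = cells F) : E = F := by
  have key : ∀ {E F : Finset (ℕ × ℕ)}, E.image Prod.fst = F.image Prod.fst →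
      E.image Prod.snd = F.image Prod.snd → cells E = cells F → E ⊆ F := by
    intro E F hO hC h e he
    have h1 : cell (E.image Prod.fst) (E.image Prod.snd) e ∈ cells F :=
      h ▸ Finset.mem_image_of_mem _ he
    obtain ⟨f, hf, hfe⟩ := Finset.mem_image.1 h1
    rw [← hO, ← hC] at hfe
    have := cell_injOn (f := e) (by rw [hO, hC]; exact mem_images hf) (mem_images he) hfe
    exact this ▸ hf
  exact Finset.Subset.antisymm (key hO hC h) (key hO.symm hC.symm h.symm)

/-- Columns enumerate `O` and rows enumerate `C`, so a full placement is a bijection from `O` to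
`C`; only the condition that openers precede closers needs an assumption. -/
theorem exists_edgeSet_of_isFull {O C : Finset ℕ} {N : ℕ} {R : Finset (ℕ × ℕ)}
    (hd : ∀ t ∈ O, t ∉ C) (hO : O.card = N) (hC : C.card = N) (hR : IsFull N R)
    (hlt : ∀ o ∈ O, ∀ c ∈ C, cell O C (o, c) ∈ R → o < c) :
    ∃ E, IsEdgeSet E ∧ E.image Prod.fst = O ∧ E.image Prod.snd = C ∧ cells E = R := by
  set E := (O ×ˢ C).filter (fun e => cell O C e ∈ R) with hE_def
  have hmem : ∀ e, e ∈ E ↔ (e.1 ∈ O ∧ e.2 ∈ C) ∧ cell O C e ∈ R := fun e => by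
    rw [hE_def, Finset.mem_filter, Finset.mem_product]
  have hsurj : ∀ r ∈ R, ∃ e ∈ E, cell O C e = r := by
    intro r hr
    have h1 : r.1 ∈ O.image (countBelow O) := by
      rw [image_countBelow, hO, ← hR.image_fst]
      exact Finset.mem_image_of_mem _ hr
    have h2 : r.2 ∈ C.image (fun s => (C.filter (s < ·)).card) := by
      rw [image_card_filter_lt, hC, ← hR.image_snd]
      exact Finset.mem_image_of_mem _ hr
    obtain ⟨o, ho, h1⟩ := Finset.mem_image.1 h1
    obtain ⟨c, hc, h2⟩ := Finset.mem_image.1 h2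
    have h3 : cell O C (o, c) = r := Prod.ext h1 h2
    exact ⟨(o, c), (hmem _).2 ⟨⟨ho, hc⟩, h3 ▸ hr⟩, h3⟩
  have h1 : E.image Prod.fst = O := by
    ext t
    rw [Finset.mem_image]
    constructor
    · rintro ⟨e, he, rfl⟩
      exact ((hmem e).1 he).1.1
    · intro ht
      have h1 : countBelow O t ∈ R.image Prod.fst := by
        rw [hR.image_fst, ← hO, ← image_countBelow]
        exact Finset.mem_image_of_mem _ ht
      obtain ⟨r, hr, h1⟩ := Finset.mem_image.1 h1
      obtain ⟨e, he, rfl⟩ := hsurj r hr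
      exact ⟨e, he, countBelow_injOn ((hmem e).1 he).1.1 ht h1⟩
  have h2 : E.image Prod.snd = C := by
    ext t
    rw [Finset.mem_image]
    constructor
    · rintro ⟨e, he, rfl⟩
      exact ((hmem e).1 he).1.2
    · intro ht
      have h1 : (C.filter (t < ·)).card ∈ R.image Prod.snd := by
        rw [hR.image_snd, ← hC, ← image_card_filter_lt]
        exact Finset.mem_image_of_mem (fun s => (C.filter (s < ·)).card) ht
      obtain ⟨r, hr, h1⟩ := Finset.mem_image.1 h1
      obtain ⟨e, he, rfl⟩ := hsurj r hr
      exact ⟨e, he, card_filter_lt_injOn ((hmem e).1 he).1.2 ht h1⟩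
  refine ⟨E, ⟨fun e he => ?_, fun e he f hf h => ?_, fun e he f hf h => ?_, fun e he f hf h => ?_⟩,
    h1, h2, ?_⟩
  · exact hlt e.1 ((hmem e).1 he).1.1 e.2 ((hmem e).1 he).1.2 ((hmem e).1 he).2
  · rw [hmem] at he hf
    exact cell_injOn he.1 hf.1 (hR.fst_inj _ he.2 _ hf.2 (by simp only [cell, h]))
  · rw [hmem] at he hf
    exact cell_injOn he.1 hf.1 (hR.snd_inj _ he.2 _ hf.2 (by simp only [cell, h]))
  · rw [hmem] at he hf
    exact hd _ he.1.1 (h ▸ hf.1.2)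
  · ext r
    rw [cells, h1, h2, Finset.mem_image]
    constructor
    · rintro ⟨e, he, rfl⟩
      exact ((hmem e).1 he).2
    · exact hsurj r

end

/-- Pigeonhole: the columns from `x` on contain `N - x` rooks in distinct rows, too many for the `y`
rows below row `y`. -/
theorem IsFull.exists_ge {N : ℕ} {R : Finset (ℕ × ℕ)} (hR : IsFull N R) {x y : ℕ}
    (h : x + y < N) : ∃ r ∈ R, x ≤ r.1 ∧ y ≤ r.2 := by
  by_contra hc
  push Not at hc
  have h1 : (R.filter (fun r => x ≤ r.1)).image Prod.fst = Finset.Ico x N := by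
    ext t
    simp only [Finset.mem_image, Finset.mem_filter, Finset.mem_Ico]
    constructor
    · rintro ⟨r, ⟨hr, h1⟩, rfl⟩
      have := Finset.mem_image_of_mem Prod.fst hr
      rw [hR.image_fst, Finset.mem_range] at this
      exact ⟨h1, this⟩
    · rintro ⟨h1, h2⟩
      have : t ∈ R.image Prod.fst := by rwa [hR.image_fst, Finset.mem_range]
      obtain ⟨r, hr, rfl⟩ := Finset.mem_image.1 this
      exact ⟨r, ⟨hr, h1⟩, rfl⟩
  have h2 : (R.filter (fun r => x ≤ r.1)).image Prod.snd ⊆ Finset.range y := by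
    intro t ht
    obtain ⟨r, hr, rfl⟩ := Finset.mem_image.1 ht
    rw [Finset.mem_filter] at hr
    exact Finset.mem_range.2 (hc r hr.1 hr.2)
  have h3 := Finset.card_le_card h2
  have h4 := congrArg Finset.card h1
  rw [Finset.card_image_of_injOn fun r hr s hs h =>
    hR.snd_inj r (Finset.mem_filter.1 hr).1 s (Finset.mem_filter.1 hs).1 h] at h3
  rw [Finset.card_image_of_injOn fun r hr s hs h =>
    hR.fst_inj r (Finset.mem_filter.1 hr).1 s (Finset.mem_filter.1 hs).1 h] at h4
  rw [Finset.card_range] at h3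
  rw [Nat.card_Ico] at h4
  omega

/-! ### Ferrers boards and Dyck words -/

theorem mem_board {w : List DyckStep} {s : ℕ × ℕ} :
    s ∈ board w ↔ ∃ t ≤ w.length, s.1 < (vertex w t).1 ∧ s.2 < (vertex w t).2 := by
  simp [board, rect]

theorem isLowerSet_board (w : List DyckStep) : IsLowerSet (board w) := by
  intro a b hba ha
  rw [mem_board] at ha ⊢
  obtain ⟨t, ht, h1, h2⟩ := ha
  exact ⟨t, ht, hba.1.trans_lt h1, hba.2.trans_lt h2⟩

theorem cell_mem_board {w : List DyckStep} {o c : ℕ} (ho : o ∈ positions DyckStep.U w)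
    (hc : c ∈ positions DyckStep.D w) :
    cell (positions DyckStep.U w) (positions DyckStep.D w) (o, c) ∈ board w ↔ o < c := by
  simp only [mem_board, vertex_eq, cell, countBelow_lt_iff ho, card_filter_lt_lt_iff hc]
  constructor
  · rintro ⟨t, -, h1, h2⟩
    omega
  · intro h
    exact ⟨c, (lt_length_of_mem_positions hc).le, h, le_rfl⟩

section

variable {v w : DyckWord} {N : ℕ}

theorem countBelow_positions_add (w : List DyckStep) {t : ℕ} (h : t ≤ w.length) :
    countBelow (positions DyckStep.U w) t + countBelow (positions DyckStep.D w) t = t := by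
  induction t with
  | zero => simp [countBelow_zero]
  | succ t ih =>
    have ih := ih (by omega)
    rw [countBelow_succ, countBelow_succ]
    rcases mem_positions_or (w := w) (t := t) (by omega) with h1 | h1
    · rw [if_pos h1, if_neg (positions_disjoint h1)]
      omega
    · rw [if_pos h1, if_neg fun h => positions_disjoint h h1]
      omega

theorem two_mul_vertex (hw : w.semilength = N) {t : ℕ} (ht : t ≤ 2 * N) :
    2 * ((vertex w.toList t).1 : ℤ) = height w.toList t + t ∧
      2 * ((vertex w.toList t).2 : ℤ) = height w.toList t + 2 * N - t := by
  have h1 := countBelow_positions_add w.toList (t := t) (by rw [length_eq]; omega)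
  have h2 := height_eq w.toList t
  have h3 := card_positions DyckStep.D w
  have h4 := Finset.card_filter_add_card_filter_not (s := positions DyckStep.D w.toList) (t ≤ ·)
  simp only [not_le] at h4
  rw [vertex_eq]
  unfold countBelow at *
  dsimp only
  omega

theorem vertex_fst_mono (w : List DyckStep) {s t : ℕ} (h : s ≤ t) :
    (vertex w s).1 ≤ (vertex w t).1 := by
  simp only [vertex_eq]
  exact countBelow_mono _ h

theorem vertex_snd_anti (w : List DyckStep) {s t : ℕ} (h : s ≤ t) :
    (vertex w t).2 ≤ (vertex w s).2 := by
  simp only [vertex_eq]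
  exact Finset.card_le_card fun x hx => by
    simp only [Finset.mem_filter] at hx ⊢
    exact ⟨hx.1, by omega⟩

theorem board_subset_iff (hv : v.semilength = N) (hw : w.semilength = N) :
    board v.toList ⊆ board w.toList ↔ ∀ t, height v.toList t ≤ height w.toList t := by
  have hlv := length_eq v
  have hlw := length_eq w
  constructor
  · intro h t
    by_cases ht : t ≤ 2 * N
    · by_contra hc
      have h1 := two_mul_vertex hv ht
      have h2 := two_mul_vertex hw ht
      have h3 := height_nonneg w t
      have h4 : (vertex w.toList t).1 < (vertex v.toList t).1 := by omega
      have h5 : (vertex w.toList t).2 < (vertex v.toList t).2 := by omega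
      -- The square in the corner below the vertex of `v` lies outside the board of `w`: the
      -- vertices of `w` up to `t` are too far left, and those from `t` on too low.
      have h6 : ((vertex v.toList t).1 - 1, (vertex v.toList t).2 - 1) ∈ board v.toList :=
        mem_board.2 ⟨t, by omega, by simp only; omega, by simp only; omega⟩
      obtain ⟨s, hs, h7, h8⟩ := mem_board.1 (h h6)
      simp only at h7 h8
      rcases le_total s t with hst | hst
      · have := vertex_fst_mono w.toList hst
        omega
      · have := vertex_snd_anti w.toList hst
        omega
    · rw [height_eq_of_semilength hv (by omega), height_eq_of_semilength hw (by omega)]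
  · intro h s hs
    obtain ⟨t, ht, h1, h2⟩ := mem_board.1 hs
    have h3 := two_mul_vertex hv (t := t) (by omega)
    have h4 := two_mul_vertex hw (t := t) (by omega)
    have h5 := h t
    exact mem_board.2 ⟨t, by omega, by omega, by omega⟩

theorem eq_of_board_eq (h : v.semilength = w.semilength)
    (hb : board v.toList = board w.toList) : v = w :=
  dyckWord_ext h fun t _ => le_antisymm ((board_subset_iff h rfl).1 hb.subset t)
    ((board_subset_iff rfl h).1 hb.symm.subset t)

/-- If the square in the last column and row `k - 1` is on the board, the path reaches its last
column with at least `k` south steps left, so its last `k` steps are south. -/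
theorem height_of_mem_board {n k : ℕ} (hv : v.semilength = n + k) (hk : 0 < k)
    (h : (n + k - 1, k - 1) ∈ board v.toList) : height v.toList (2 * n + k) = k := by
  have hlen := length_eq v
  obtain ⟨t, ht, h1, h2⟩ := mem_board.1 h
  simp only at h1 h2
  have h3 := two_mul_vertex hv (t := t) (by omega)
  have h4 := two_mul_vertex hv (t := 2 * n + k) (by omega)
  have h5 := two_mul_vertex hv (t := 2 * (n + k)) le_rfl
  rw [height_eq_of_semilength hv le_rfl] at h5
  have h6 := vertex_fst_mono v.toList (s := t) (t := 2 * (n + k)) (by omega)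
  have h7 := vertex_fst_mono v.toList (s := 2 * n + k) (t := 2 * (n + k)) (by omega)
  have h8 := vertex_fst_mono v.toList (s := t) (t := 2 * n + k)
  push_cast at *
  omega

open scoped Classical in
/-- The vertices of the border of the Ferrers board `Λ`, from the point `(0, N)` on. -/
noncomputable def walk (Λ : Set (ℕ × ℕ)) (N : ℕ) : ℕ → ℕ × ℕ
  | 0 => (0, N)
  -- From `(x, y)` the border continues east over the square `(x, y - 1)` if this square belongs to
  -- the board, and otherwise goes south along its left side.
  | t + 1 => if ((walk Λ N t).1, (walk Λ N t).2 - 1) ∈ Λ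
      then ((walk Λ N t).1 + 1, (walk Λ N t).2) else ((walk Λ N t).1, (walk Λ N t).2 - 1)

/-- Along the walk, the square north-east of the vertex stays outside `Λ` and the square south-west
of it, if any, stays inside, so the walk follows the border. The staircase inside `Λ` keeps it
weakly above the diagonal. -/
theorem exists_dyckWord_board {Λ : Set (ℕ × ℕ)} (hΛ : IsLowerSet Λ)
    (hsub : ∀ s ∈ Λ, s.1 < N ∧ s.2 < N) (hst : ∀ x y, x + y < N → (x, y) ∈ Λ) :
    ∃ v : DyckWord, v.semilength = N ∧ board v.toList = Λ := by
  classical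
  have hinv : ∀ t ≤ 2 * N, (walk Λ N t).1 + N = (walk Λ N t).2 + t ∧ (walk Λ N t).1 ≤ N ∧
      (walk Λ N t).2 ≤ N ∧ walk Λ N t ∉ Λ ∧
      (0 < (walk Λ N t).1 → 0 < (walk Λ N t).2 →
        ((walk Λ N t).1 - 1, (walk Λ N t).2 - 1) ∈ Λ) := by
    intro t
    induction t with
    | zero =>
      intro
      refine ⟨by simp [walk], by simp [walk], by simp [walk], fun h => ?_, by simp [walk]⟩
      have := (hsub _ h).2
      simp [walk] at this
    | succ t ih =>
      intro ht
      obtain ⟨i1, i2, i3, i4, i5⟩ := ih (by omega)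
      -- This guards the truncated subtraction: on the axis the first coordinate would be `t - N <
      -- N`, and the staircase would put the vertex into `Λ`.
      have hy : 0 < (walk Λ N t).2 := by
        by_contra hc
        refine i4 (hst _ _ ?_)
        omega
      rw [walk]
      split_ifs with h
      · have hx := (hsub _ h).1
        simp only at hx
        refine ⟨by simp only; omega, hx, i3, fun h' => i4 (hΛ ⟨?_, ?_⟩ h'), fun _ _ => h⟩
        · exact Nat.le_succ _
        · exact le_rfl
      · refine ⟨by simp only; omega, i2, by simp only; omega, h, fun h1 h2 => ?_⟩
        exact hΛ (a := ((walk Λ N t).1 - 1, (walk Λ N t).2 - 1))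
          ⟨le_rfl, Nat.sub_le_sub_right (Nat.sub_le _ _) 1⟩ (i5 h1 hy)
  have hstep : ∀ t, (walk Λ N (t + 1) = ((walk Λ N t).1 + 1, (walk Λ N t).2)) ∨
      walk Λ N (t + 1) = ((walk Λ N t).1, (walk Λ N t).2 - 1) := fun t => by
    rw [walk]
    split_ifs
    exacts [Or.inl rfl, Or.inr rfl]
  have hsum : ∀ t ≤ 2 * N, N ≤ (walk Λ N t).1 + (walk Λ N t).2 := fun t ht => by
    by_contra hc
    exact (hinv t ht).2.2.2.1 (hst _ _ (by omega))
  obtain ⟨v, hv, hb⟩ := exists_dyckWord (N := N)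
    (b := fun t => ((walk Λ N t).1 : ℤ) + (walk Λ N t).2 - N) (by simp [walk])
    (fun t ht => by
      have h1 := hinv t (by omega)
      have h2 := hinv (t + 1) (by omega)
      rcases hstep t with h | h <;> rw [h] at h2 ⊢ <;> dsimp only at h2 ⊢ <;> omega)
    (fun t ht => by have := hsum t ht; omega)
    (by have := hinv (2 * N) le_rfl; omega)
  have hvert : ∀ t ≤ 2 * N, vertex v.toList t = walk Λ N t := fun t ht => by
    have h1 := two_mul_vertex hv ht
    rw [hb t ht] at h1
    have h2 := hinv t ht
    exact Prod.ext (by omega) (by omega)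
  have hlen := length_eq v
  refine ⟨v, hv, Set.ext fun s => ?_⟩
  rw [mem_board]
  constructor
  · rintro ⟨t, ht, h1, h2⟩
    rw [hvert t (by omega)] at h1 h2
    exact hΛ ⟨by simp only; omega, by simp only; omega⟩
      ((hinv t (by omega)).2.2.2.2 (by omega) (by omega))
  · intro hs
    have h1 := hsub s hs
    -- The vertex with this index lies on the main diagonal of the square `s`, and since it is
    -- outside `Λ` it is to the north-east.
    have h2 := hinv (s.1 + N - s.2) (by omega)
    have h3 : s.1 < (walk Λ N (s.1 + N - s.2)).1 := by
      by_contra hc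
      exact h2.2.2.2.1 (hΛ ⟨by omega, by omega⟩ hs)
    refine ⟨s.1 + N - s.2, by omega, ?_⟩
    rw [hvert _ (by omega)]
    omega

end

/-! ### The bijection for `213`-avoiding matchings -/

theorem rooks_eq_cells {m : ℕ} (P : Matching m) : rooks P = cells (edges P) := rooks_eq P

theorem cells_subset_board {w : List DyckStep} {E : Finset (ℕ × ℕ)} (hE : IsEdgeSet E)
    (hO : E.image Prod.fst = positions DyckStep.U w)
    (hC : E.image Prod.snd = positions DyckStep.D w) : (cells E : Set (ℕ × ℕ)) ⊆ board w := by
  intro r hr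
  obtain ⟨e, he, rfl⟩ := Finset.mem_image.1 (Finset.mem_coe.1 hr)
  have h := mem_images he
  rw [hO, hC] at h ⊢
  exact (cell_mem_board h.1 h.2).2 (hE.lt e he)

theorem card_edgeSet {w : DyckWord} {E : Finset (ℕ × ℕ)} (hE : IsEdgeSet E)
    (hO : E.image Prod.fst = positions DyckStep.U w.toList) : E.card = w.semilength := by
  rw [← card_positions DyckStep.U w, ← hO,
    Finset.card_image_of_injOn fun e he f hf h => hE.fst_inj e he f hf h]

/-- A full rook placement in the board of a Dyck word is the rook placement of a matching. -/
theorem exists_edgeSet_of_subset_board {w : DyckWord} {R : Finset (ℕ × ℕ)}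
    (hR : IsFull w.semilength R) (hsub : (R : Set (ℕ × ℕ)) ⊆ board w.toList) :
    ∃ E, IsEdgeSet E ∧ E.image Prod.fst = positions DyckStep.U w.toList ∧
      E.image Prod.snd = positions DyckStep.D w.toList ∧ cells E = R :=
  exists_edgeSet_of_isFull (fun _ => positions_disjoint) (card_positions _ w) (card_positions _ w)
    hR fun _ ho _ hc h => (cell_mem_board ho hc).1 (hsub h)

theorem exists_of_cells_eq {E F : Finset (ℕ × ℕ)} (h : cells E = cells F) {e : ℕ × ℕ}
    (he : e ∈ E) : ∃ f ∈ F, cell (E.image Prod.fst) (E.image Prod.snd) e =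
      cell (F.image Prod.fst) (F.image Prod.snd) f := by
  have : cell (E.image Prod.fst) (E.image Prod.snd) e ∈ cells F :=
    h ▸ Finset.mem_image_of_mem _ he
  obtain ⟨f, hf, h⟩ := Finset.mem_image.1 this
  exact ⟨f, hf, h.symm⟩

/-- The board of a noncrossing matching is generated by its rooks. -/
theorem Noncrossing.board_eq {v : DyckWord} {E : Finset (ℕ × ℕ)} (hE : IsEdgeSet E)
    (hN : Noncrossing E) (hO : E.image Prod.fst = positions DyckStep.U v.toList)
    (hC : E.image Prod.snd = positions DyckStep.D v.toList) :
    board v.toList = lowerClosure (cells E : Set (ℕ × ℕ)) := by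
  apply Set.Subset.antisymm
  · rintro ⟨x, y⟩ hs
    obtain ⟨t, -, h1, h2⟩ := mem_board.1 hs
    simp only [vertex_eq] at h1 h2
    have hx : x ∈ (positions DyckStep.U v.toList).image
        (countBelow (positions DyckStep.U v.toList)) := by
      rw [image_countBelow, Finset.mem_range]
      exact h1.trans_le (Finset.card_le_card (Finset.filter_subset _ _))
    have hy : y ∈ (positions DyckStep.D v.toList).image
        (fun s => ((positions DyckStep.D v.toList).filter (s < ·)).card) := by
      rw [image_card_filter_lt, Finset.mem_range]
      exact h2.trans_le (Finset.card_le_card (Finset.filter_subset _ _))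
    obtain ⟨o, ho, rfl⟩ := Finset.mem_image.1 hx
    obtain ⟨c, hc, rfl⟩ := Finset.mem_image.1 hy
    have hoc : o < c := (cell_mem_board ho hc).1 hs
    have ho' := ho
    have hc' := hc
    rw [← hO] at ho'
    rw [← hC] at hc'
    obtain ⟨e, he, rfl⟩ := Finset.mem_image.1 ho'
    obtain ⟨f, hf, rfl⟩ := Finset.mem_image.1 hc'
    -- One of the two rooks, in the column of `e` or in the row of `f`, dominates the square: if `e`
    -- closes after `f`, then `f` cannot open before `e` without crossing it.
    have key : ∃ g ∈ E, e.1 ≤ g.1 ∧ g.2 ≤ f.2 := by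
      by_cases h3 : e.2 ≤ f.2
      · exact ⟨e, he, le_rfl, h3⟩
      · refine ⟨f, hf, ?_, le_rfl⟩
        by_contra h4
        exact hN f hf e he (by omega) hoc (by omega)
    obtain ⟨g, hg, h3, h4⟩ := key
    refine ⟨_, Finset.mem_coe.2 (Finset.mem_image_of_mem _ hg), ?_, ?_⟩
    · simp only [cell, hO]
      exact countBelow_mono _ h3
    · simp only [cell, hC]
      exact Finset.card_le_card fun x hx => by
        simp only [Finset.mem_filter] at hx ⊢
        exact ⟨hx.1, by omega⟩
  · exact lowerClosure_min (cells_subset_board hE hO hC) (isLowerSet_board _)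

/-- A matching that avoids `213` becomes noncrossing on the board that its rooks generate. -/
theorem noncrossing_of_noCrossingOverArc {v : DyckWord} {E F : Finset (ℕ × ℕ)}
    (hE : IsEdgeSet E)
    (hE3 : NoCrossingOverArc E) (hO : F.image Prod.fst = positions DyckStep.U v.toList)
    (hC : F.image Prod.snd = positions DyckStep.D v.toList) (hEF : cells E = cells F)
    (hb : board v.toList = lowerClosure (cells E : Set (ℕ × ℕ))) : Noncrossing F := by
  intro e' he' f' hf' h1 h2 h3
  obtain ⟨e, he, hee⟩ := exists_of_cells_eq hEF.symm he'
  obtain ⟨f, hf, hff⟩ := exists_of_cells_eq hEF.symm hf'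
  -- For crossing edges `e'`, `f'`, the square in the column of `f'` and the row of `e'` is on the
  -- board, hence dominated by a rook. The edge `g` of that rook in `E` is the arc below the
  -- crossing of `e` and `f`.
  have h4 : cell (positions DyckStep.U v.toList) (positions DyckStep.D v.toList) (f'.1, e'.2) ∈
      board v.toList :=
    (cell_mem_board (by rw [← hO]; exact (mem_images hf').1)
      (by rw [← hC]; exact (mem_images he').2)).2 h2
  rw [hb] at h4
  obtain ⟨r, hr, h5, h6⟩ := h4
  obtain ⟨g, hg, rfl⟩ := Finset.mem_image.1 (Finset.mem_coe.1 hr)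
  rw [← hO, ← hC] at h5 h6
  have a1 := (Prod.ext_iff.1 hff).1
  have a2 := (Prod.ext_iff.1 hee).2
  simp only [cell] at h5 h6 a1 a2
  have b1 := countBelow_lt_iff (t := f.1) (mem_images hg).1
  have b2 := card_filter_lt_lt_iff' (t := e.2) (mem_images hg).2
  have b3 := (fst_lt_of_cell_eq (mem_images he').1 (mem_images he).1 hee hff).1 h1
  have b4 := (snd_lt_of_cell_eq (mem_images hf').2 (mem_images hf).2 hee hff).1 h3
  have c1 : f.1 ≠ g.1 := fun h => by
    rw [hE.fst_inj f hf g hg h] at b4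
    omega
  have c2 : g.2 ≠ e.2 := fun h => by
    rw [hE.snd_inj g hg e he h] at b1 h5
    omega
  exact hE3 e he f hf g hg b3 (by omega) (by omega) b4

theorem exists_noncrossingPair_213 {n k : ℕ} {M : Matching (2 * n + k)}
    (hM : M ∈ matchings213 n k) : ∃ p ∈ noncrossingPairs n k, IsDelta213 M.plus p := by
  obtain ⟨hk, -⟩ := mem_matchings213.1 hM
  obtain ⟨w, hw⟩ := exists_dyckWord_border (plus_partner_ne M)
  have hs := semilength_of_border hk hw
  have hE := isEdgeSet_edges M.plus
  have hO := image_fst_of_border hw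
  have hC := image_snd_of_border hw
  have hR := hE.isFull_cells
  rw [card_edgeSet hE hO, hs] at hR
  obtain ⟨v, hv, hb⟩ := exists_dyckWord_board (N := n + k)
    (lowerClosure (cells (edges M.plus) : Set (ℕ × ℕ))).lower
    (by
      rintro s ⟨r, hr, hsr⟩
      have h1 := Finset.mem_image_of_mem Prod.fst (Finset.mem_coe.1 hr)
      have h2 := Finset.mem_image_of_mem Prod.snd (Finset.mem_coe.1 hr)
      rw [hR.image_fst, Finset.mem_range] at h1
      rw [hR.image_snd, Finset.mem_range] at h2
      exact ⟨hsr.1.trans_lt h1, hsr.2.trans_lt h2⟩)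
    (fun x y h => by
      obtain ⟨r, hr, h1, h2⟩ := hR.exists_ge h
      exact ⟨r, Finset.mem_coe.2 hr, h1, h2⟩)
  refine ⟨(v, w), ⟨hv, hs, (board_subset_iff hv hs).1 ?_, ?_, suffix_of_border hk hw⟩, hw, ?_⟩
  · rw [hb]
    exact lowerClosure_min (cells_subset_board hE hO hC) (isLowerSet_board _)
  · rw [suffix_iff_height hv]
    rcases Nat.eq_zero_or_pos k with rfl | hpos
    · exact height_eq_of_semilength hv (by omega)
    refine height_of_mem_board hv hpos ?_
    rw [hb]
    -- The rook of the last column must lie in row `k - 1` or higher. Otherwise it is to the right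
    -- of and below the rook in row `k - 1`, with both in the lowest `k` rows. These rows belong to
    -- the tail edges, whose rooks increase because they are nested.
    have h1 : n + k - 1 ∈ (cells (edges M.plus)).image Prod.fst := by
      rw [hR.image_fst, Finset.mem_range]
      omega
    have h2 : k - 1 ∈ (cells (edges M.plus)).image Prod.snd := by
      rw [hR.image_snd, Finset.mem_range]
      omega
    obtain ⟨r, hr, h1⟩ := Finset.mem_image.1 h1
    obtain ⟨s, hsR, h2⟩ := Finset.mem_image.1 h2
    refine ⟨r, Finset.mem_coe.2 hr, h1.ge, ?_⟩
    by_contra hc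
    have hc : r.2 < k - 1 := not_le.1 hc
    have hlt : s.1 < r.1 := by
      have h3 := Finset.mem_image_of_mem Prod.fst hsR
      rw [hR.image_fst, Finset.mem_range] at h3
      have h4 : s.1 ≠ r.1 := fun h => by
        rw [hR.fst_inj s hsR r hr h] at h2
        omega
      omega
    obtain ⟨e, he, rfl⟩ := Finset.mem_image.1 hr
    obtain ⟨f, hf, rfl⟩ := Finset.mem_image.1 hsR
    have hcard : (((edges M.plus).image Prod.snd).filter (2 * n + k ≤ ·)).card = k := by
      have h3 := two_mul_vertex hs (t := 2 * n + k) (by omega)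
      rw [(suffix_iff_height hs).1 (suffix_of_border hk hw), vertex_eq, ← hC] at h3
      dsimp only at h3
      push_cast at h3
      omega
    simp only [cell] at hc h2 hlt
    have he2 := card_filter_lt_lt_iff (t := 2 * n + k) (mem_images he).2
    have hf2 := card_filter_lt_lt_iff (t := 2 * n + k) (mem_images hf).2
    have hfe := countBelow_lt_iff (t := e.1) (mem_images hf).1
    have := nested_tailEdges_plus M f (mem_tailEdges.2 ⟨hf, by omega⟩) e
      (mem_tailEdges.2 ⟨he, by omega⟩) (by omega)
    have := (card_filter_lt_lt_iff' (t := e.2) (mem_images hf).2).2 this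
    omega
  · rw [rooks_eq_cells]
    exact hb

/-- The noncrossing matching on the steps of `D₀` supplies the rooks; read on the larger board of
`D₁`, they give the required matching. -/
theorem exists_matching_213 {n k : ℕ} {p : DyckWord × DyckWord}
    (hp : p ∈ noncrossingPairs n k) : ∃ M ∈ matchings213 n k, IsDelta213 M.plus p := by
  obtain ⟨v, w⟩ := p
  obtain ⟨hv, hw, hle, hkv, hkw⟩ := hp
  dsimp only at hv hw hle hkv hkw
  have hlv := length_eq v
  have hlw := length_eq w
  obtain ⟨F, hF, hFN, hFO, hFC⟩ := exists_noncrossing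
    (O := positions DyckStep.U v.toList) (C := positions DyckStep.D v.toList)
    (fun _ => positions_disjoint) (by rw [card_positions, card_positions]) (fun t => by
      have h1 := height_eq v.toList t
      have h2 := height_nonneg v t
      omega)
  have hR := hF.isFull_cells
  rw [card_edgeSet hF hFO, hv, ← hw] at hR
  obtain ⟨E, hE, hO, hC, hEF⟩ := exists_edgeSet_of_subset_board hR
    ((cells_subset_board hF hFO hFC).trans ((board_subset_iff hv hw).2 hle))
  have hcard : ∀ {u : DyckWord}, u.semilength = n + k →
      List.replicate k DyckStep.D <:+ u.toList →
      ((positions DyckStep.D u.toList).filter (2 * n + k ≤ ·)).card = k := fun {u} hu hku => by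
    have h3 := two_mul_vertex hu (t := 2 * n + k) (by omega)
    rw [(suffix_iff_height hu).1 hku, vertex_eq] at h3
    dsimp only at h3
    push_cast at h3
    omega
  have hN : Nested (live E (2 * n + k)) := by
    intro e he f hf hlt
    obtain ⟨he, -, he2⟩ := mem_live.1 he
    obtain ⟨hf, -, hf2⟩ := mem_live.1 hf
    obtain ⟨e', he', hee⟩ := exists_of_cells_eq hEF he
    obtain ⟨f', hf', hff⟩ := exists_of_cells_eq hEF hf
    by_contra hc
    have hlt2 : e.2 < f.2 := by
      have : e.2 ≠ f.2 := fun h => by rw [hE.snd_inj e he f hf h] at hlt; omega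
      omega
    have h1 := (fst_lt_of_cell_eq (mem_images he).1 (mem_images he').1 hee hff).1 hlt
    have h2 := (snd_lt_of_cell_eq (mem_images hf).2 (mem_images hf').2 hee hff).1 hlt2
    refine hFN e' he' f' hf' h1 ?_ h2
    -- The row of `e` is among the lowest `k`, so `e'` closes within the last `k` steps of `D₀`.
    -- These are all south, so the opener of `f'` comes before and `e'`, `f'` cross.
    have h3 := (card_filter_lt_lt_iff (mem_images he).2).2 he2
    have h4 := (Prod.ext_iff.1 hee).2
    simp only [cell] at h4
    rw [h4, hC, hcard hw hkw, ← hcard hv hkv, ← hFC,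
      card_filter_lt_lt_iff (mem_images he').2] at h3
    by_contra h5
    have h6 := mem_positions_of_suffix hkv (t := f'.1) (by omega) (by
      have h7 := (mem_images hf').1
      rw [hFO] at h7
      exact lt_length_of_mem_positions h7)
    exact positions_disjoint (by rw [← hFO]; exact (mem_images hf').1) h6
  obtain ⟨M, hM, rfl, hb⟩ := exists_plus_of_dyckWord hw hkw hE hO hC hN
  refine ⟨M, mem_matchings213.2 ⟨hM, ?_⟩, hb, ?_⟩
  · intro e he f hf g hg h1 h2 h3 h4
    obtain ⟨e', he', hee⟩ := exists_of_cells_eq hEF he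
    obtain ⟨f', hf', hff⟩ := exists_of_cells_eq hEF hf
    obtain ⟨g', hg', hgg⟩ := exists_of_cells_eq hEF hg
    have a1 := (fst_lt_of_cell_eq (mem_images he).1 (mem_images he').1 hee hff).1 h1
    have a2 := (fst_lt_of_cell_eq (mem_images hf).1 (mem_images hf').1 hff hgg).1 h2
    have a3 := (snd_lt_of_cell_eq (mem_images he).2 (mem_images he').2 hgg hee).1 h3
    have a4 := (snd_lt_of_cell_eq (mem_images hf).2 (mem_images hf').2 hee hff).1 h4
    have a5 := hF.lt g' hg'
    -- The arc `g'` gives `f'.1 < g'.1 < g'.2 < e'.2`, so `e'` and `f'` cross on the board of `D₀`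
    -- as well.
    exact hFN e' he' f' hf' a1 (by omega) a4
  · rw [rooks_eq_cells, hEF]
    exact hFN.board_eq hF hFO hFC

/-- `D₀` determines the noncrossing matching carried by the rooks, hence the rooks, and these
together with `D₁` determine `M.plus`. -/
theorem isDelta213_left_unique {n k : ℕ} {M M' : Matching (2 * n + k)}
    (hM : M ∈ matchings213 n k) (hM' : M' ∈ matchings213 n k) {p : DyckWord × DyckWord}
    (hp : p ∈ noncrossingPairs n k) (h : IsDelta213 M.plus p) (h' : IsDelta213 M'.plus p) :
    M = M' := by
  have key : ∀ {M : Matching (2 * n + k)}, M ∈ matchings213 n k → IsDelta213 M.plus p →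
      ∃ F, IsEdgeSet F ∧ Noncrossing F ∧ F.image Prod.fst = positions DyckStep.U p.1.toList ∧
        F.image Prod.snd = positions DyckStep.D p.1.toList ∧ cells F = cells (edges M.plus) := by
    intro M hM h
    obtain ⟨-, h3⟩ := mem_matchings213.1 hM
    have hE := isEdgeSet_edges M.plus
    have hb := h.2
    rw [rooks_eq_cells] at hb
    have hR := hE.isFull_cells
    rw [card_edgeSet hE (image_fst_of_border h.1), hp.2.1, ← hp.1] at hR
    obtain ⟨F, hF, hFO, hFC, hFE⟩ := exists_edgeSet_of_subset_board hR
      (hb ▸ subset_lowerClosure)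
    exact ⟨F, hF, noncrossing_of_noCrossingOverArc hE h3 hFO hFC hFE.symm hb, hFO, hFC, hFE⟩
  obtain ⟨F, hF, hFN, hFO, hFC, hFE⟩ := key hM h
  obtain ⟨F', hF', hFN', hFO', hFC', hFE'⟩ := key hM' h'
  have hFF : F = F' :=
    noncrossing_unique hF hF' hFN hFN' (hFO.trans hFO'.symm) (hFC.trans hFC'.symm)
  refine plus_injective (eq_of_cells_eq ?_ ?_ ?_)
  · rw [image_fst_of_border h.1, image_fst_of_border h'.1]
  · rw [image_snd_of_border h.1, image_snd_of_border h'.1]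
  · rw [← hFE, ← hFE', hFF]

theorem isDelta213_right_unique {n k : ℕ} {M : Matching (2 * n + k)} {p p' : DyckWord × DyckWord}
    (hp : p ∈ noncrossingPairs n k) (hp' : p' ∈ noncrossingPairs n k) (h : IsDelta213 M.plus p)
    (h' : IsDelta213 M.plus p') : p = p' :=
  Prod.ext (eq_of_board_eq (hp.1.trans hp'.1.symm) (h.2.trans h'.2.symm))
    (DyckWord.ext (h.1.trans h'.1.symm))

theorem exists_equiv_213 (n k : ℕ) : ∃ Φ : matchings213 n k ≃ noncrossingPairs n k,
    ∀ M : matchings213 n k, IsDelta213 M.1.plus (Φ M).1 :=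
  exists_equiv_of_rel (R := fun M p => IsDelta213 M.plus p)
    (fun _ hM => exists_noncrossingPair_213 hM) (fun _ hp => exists_matching_213 hp)
    (fun _ hM _ hM' _ hp h h' => isDelta213_left_unique hM hM' hp h h')
    (fun _ _ _ hp _ hp' h h' => isDelta213_right_unique hp hp' h h')

end MatchingPaths

theorem mainTheorem9 (n k : ℕ) :
    (∃ Φ : MatchingPaths.matchings321 n k ≃ MatchingPaths.noncrossingPairs n k,
      ∀ M : MatchingPaths.matchings321 n k,
        MatchingPaths.IsDelta321 M.1.plus (Φ M).1) ∧
    (∃ Φ : MatchingPaths.matchings213 n k ≃ MatchingPaths.noncrossingPairs n k,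
      ∀ M : MatchingPaths.matchings213 n k,
        MatchingPaths.IsDelta213 M.1.plus (Φ M).1) :=
  ⟨MatchingPaths.exists_equiv_321 n k, MatchingPaths.exists_equiv_213 n k⟩
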